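/- **Theorem (Another sufficient condition for factorization).** Let $\Gamma=(\Gamma,+,0,\le)$ be a divisible totally ordered abelian group (possibly trivial), and let $\mathbb{T}_{\max}=(\Gamma\cup\{\bot\},\max,+)$ be the tropical semifield over $\Gamma$, with addition $\oplus=\max$, multiplication $\odot=+$ and zero element $\bot$. Equip $\mathbb{T}_{\max}^2$ with $(a_1,a_2)\oplus(b_1,b_2)=(a_1\oplus b_1,a_2\oplus b_2)$, $(a_1,a_2)\odot(b_1,b_2)=(a_1\odot b_1\oplus a_2\odot b_2,\ a_1\odot b_2\oplus a_2\odot b_1)$, $\ominus(a_1,a_2)=(a_2,a_1)$, and the balance relation $(a_1,a_2)\,\nabla\,(b_1,b_2)\iff a_1\oplus b_2=a_2\oplus b_1$. Let $\mathbb{S}_{\max}=\mathbb{T}_{\max}^2/\mathcal{R}$ be the symmetrized tropical semiring, where $a\,\mathcal{R}\,b$ means $a\,\nabla\, b$ if $a_1\ne a_2$ and $b_1\neq b_2$, and $a=b$ otherwise; the operations $\oplus,\odot,\ominus$ and the relation $\nabla$ pass to the quotient. Denote by $\mathbf 0=\overline{(\bot,\bot)}$ its zero element and by $\mathbb{S}_{\max}^\vee=\{\overline{(c,\bot)},\overline{(\bot,c)}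 : c\in\mathbb{T}_{\max}\}$ the set of signed elements. A formal polynomial $P=\bigoplus_k P_k\mathsf{Y}^k\in\mathbb{S}_{\max}[\mathsf{Y}]$ has the associated polynomial function $\widehat P:\mathbb{S}_{\max}\to\mathbb{S}_{\max}$, $\widehat P(y)=\bigoplus_k P_k\odot y^{\odot k}$; let $\mathbb{S}_{\max}^\vee[\mathsf{Y}]$ be the set of formal polynomials with coefficients in $\mathbb{S}_{\max}^\vee$. For $P\in\mathbb{S}_{\max}^\vee[\mathsf{Y}]$, an element $a\in \mathbb{S}_{\max}^\vee$ is a root of $P$ if $\widehat P(a)\,\nabla\,\mathbf 0$. The multiplicity $\mathrm{mult}_a(P)$ is defined recursively: it is $0$ if $a$ is not a root of $P$, and otherwise $$\mathrm{mult}_a(P)=1+\max\{\mathrm{mult}_a(Q) : Q\in\mathbb{S}_{\max}^\vee[\mathsf{Y}],\ \lambda\in\mathbb{S}_{\max}^\vee\setminus\{\mathbf 0\},\ \lambda P\,\nabla\,(\mathsf{Y}\ominus a)Q\},$$ where $\nabla$ is applied coefficientwise. Let $P\in\mathbb{S}_{\max}^\vee[\mathsf{Y}]$ have degree $n\ge 0$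 (so $P\neq\mathbf 0$) and have $n$ roots $r_1,\dots,r_n\in\mathbb{S}_{\max}^\vee$ counted with multiplicity, that is, every $a\in\mathbb{S}_{\max}^\vee$ occurs exactly $\mathrm{mult}_a(P)$ times in the list $r_1,\dots,r_n$. Then, for all $y\in\mathbb{S}_{\max}$, $$\widehat P(y)=P_n\odot(y\ominus r_1)\odot\cdots\odot(y\ominus r_n).$$ -/

import Mathlib

set_option linter.unusedSectionVars false

/-- The tropical semifield `T_max(Γ) = (Γ ∪ {⊥}, max, +)` of a totally ordered abelian group `Γ`.
Below, `+` on `Tmax Γ` is the tropical addition `max`, `*` is the addition of `Γ` extended by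
`⊥ * a = a * ⊥ = ⊥`, `0` is `⊥`, and `1` is the neutral element of `Γ`. -/
def Tmax (Γ : Type*) : Type _ := WithBot Γ

namespace Tmax

variable {Γ : Type*} [AddCommGroup Γ] [LinearOrder Γ] [IsOrderedAddMonoid Γ]

instance instLinearOrder : LinearOrder (Tmax Γ) := inferInstanceAs (LinearOrder (WithBot Γ))

instance instZero : Zero (Tmax Γ) := ⟨(⊥ : WithBot Γ)⟩
instance instOne : One (Tmax Γ) := ⟨(0 : WithBot Γ)⟩
instance instAdd : Add (Tmax Γ) := ⟨fun a b => max a b⟩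
instance instMul : Mul (Tmax Γ) := ⟨fun a b => Add.add (α := WithBot Γ) a b⟩

instance instCommSemiring : CommSemiring (Tmax Γ) where
  nsmul := nsmulRec
  add_assoc a b c := max_assoc a b c
  add_comm a b := max_comm a b
  zero_add a := bot_sup_eq (α := WithBot Γ) a
  add_zero a := sup_bot_eq (α := WithBot Γ) a
  mul_assoc a b c := add_assoc (G := WithBot Γ) a b c
  mul_comm a b := add_comm (G := WithBot Γ) a b
  one_mul a := zero_add (M := WithBot Γ) a
  mul_one a := add_zero (M := WithBot Γ) a
  zero_mul a := WithBot.bot_add (α := Γ) a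
  mul_zero a := WithBot.add_bot (α := Γ) a
  left_distrib a b c := (max_add_add_left (α := WithBot Γ) a b c).symm
  right_distrib a b c := (max_add_add_right (α := WithBot Γ) a b c).symm

theorem add_eq_max (a b : Tmax Γ) : a + b = max a b := rfl

theorem zero_le' (a : Tmax Γ) : 0 ≤ a := bot_le (α := WithBot Γ)

theorem mul_lt_mul_left' {a b c : Tmax Γ} (hc : c ≠ 0) (h : a < b) : c * a < c * b :=
  WithBot.add_lt_add_left (α := Γ) (x := c) hc h

theorem mul_le_mul_left' {a b : Tmax Γ} (c : Tmax Γ) (h : a ≤ b) : c * a ≤ c * b :=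
  by
  have e : c * (a + b) = c * a + c * b := mul_add c a b
  rw [add_eq_max, max_eq_right h, add_eq_max] at e
  exact e ▸ le_max_left _ _

end Tmax

/-- The set `T_max²` of pairs; its multiplication is the one of formal differences. -/
@[ext] structure TmaxPair (Γ : Type*) where
  fst : Tmax Γ
  snd : Tmax Γ

namespace TmaxPair

variable {Γ : Type*} [AddCommGroup Γ] [LinearOrder Γ] [IsOrderedAddMonoid Γ]

instance instZero : Zero (TmaxPair Γ) := ⟨⟨0, 0⟩⟩
instance instOne : One (TmaxPair Γ) := ⟨⟨1, 0⟩⟩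
instance instAdd : Add (TmaxPair Γ) := ⟨fun a b => ⟨a.fst + b.fst, a.snd + b.snd⟩⟩
instance instMul : Mul (TmaxPair Γ) :=
  ⟨fun a b => ⟨a.fst * b.fst + a.snd * b.snd, a.fst * b.snd + a.snd * b.fst⟩⟩
/-- The minus operator `⊖ (a₁, a₂) = (a₂, a₁)`. -/
instance instNeg : Neg (TmaxPair Γ) := ⟨fun a => ⟨a.snd, a.fst⟩⟩

@[simp] theorem zero_fst : (0 : TmaxPair Γ).fst = 0 := rfl
@[simp] theorem zero_snd : (0 : TmaxPair Γ).snd = 0 := rfl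
@[simp] theorem one_fst : (1 : TmaxPair Γ).fst = 1 := rfl
@[simp] theorem one_snd : (1 : TmaxPair Γ).snd = 0 := rfl
@[simp] theorem add_fst (a b : TmaxPair Γ) : (a + b).fst = a.fst + b.fst := rfl
@[simp] theorem add_snd (a b : TmaxPair Γ) : (a + b).snd = a.snd + b.snd := rfl
@[simp] theorem mul_fst (a b : TmaxPair Γ) :
    (a * b).fst = a.fst * b.fst + a.snd * b.snd := rfl
@[simp] theorem mul_snd (a b : TmaxPair Γ) :
    (a * b).snd = a.fst * b.snd + a.snd * b.fst := rfl
@[simp] theorem neg_fst (a : TmaxPair Γ) : (-a).fst = a.snd := rfl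
@[simp] theorem neg_snd (a : TmaxPair Γ) : (-a).snd = a.fst := rfl

instance instCommSemiring : CommSemiring (TmaxPair Γ) where
  nsmul := nsmulRec
  add_assoc a b c := by ext <;> simp <;> ring
  add_comm a b := by ext <;> simp <;> ring
  zero_add a := by ext <;> simp
  add_zero a := by ext <;> simp
  mul_assoc a b c := by ext <;> simp <;> ring
  mul_comm a b := by ext <;> simp <;> ring
  one_mul a := by ext <;> simp
  mul_one a := by ext <;> simp
  zero_mul a := by ext <;> simp
  mul_zero a := by ext <;> simp
  left_distrib a b c := by ext <;> simp <;> ring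
  right_distrib a b c := by ext <;> simp <;> ring

/-- The balance relation `a ∇ b` on `T_max²`: `a₁ ⊕ b₂ = a₂ ⊕ b₁`. -/
def Balances (a b : TmaxPair Γ) : Prop := a.fst + b.snd = a.snd + b.fst

/-- The relation `R` on `T_max²`: the balance relation when both pairs have distinct components,
equality otherwise. -/
def Rel (a b : TmaxPair Γ) : Prop :=
  (a.fst ≠ a.snd ∧ b.fst ≠ b.snd ∧ Balances a b) ∨ (¬ (a.fst ≠ a.snd ∧ b.fst ≠ b.snd) ∧ a = b)

theorem rel_iff (a b : TmaxPair Γ) : Rel a b ↔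
    a = b ∨ (a.snd < a.fst ∧ b.snd < b.fst ∧ a.fst = b.fst) ∨
      (a.fst < a.snd ∧ b.fst < b.snd ∧ a.snd = b.snd) := by
  obtain ⟨a1, a2⟩ := a
  obtain ⟨b1, b2⟩ := b
  simp only [Rel, Balances, Tmax.add_eq_max, TmaxPair.mk.injEq]
  grind

theorem rel_refl (a : TmaxPair Γ) : Rel a a := (rel_iff a a).2 (Or.inl rfl)

theorem rel_symm {a b : TmaxPair Γ} (h : Rel a b) : Rel b a := by
  rw [rel_iff] at *; grind

theorem rel_trans {a b c : TmaxPair Γ} (h : Rel a b) (h' : Rel b c) : Rel a c := by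
  rw [rel_iff] at *; grind

theorem rel_add_right {a b : TmaxPair Γ} (c : TmaxPair Γ) (h : Rel a b) :
    Rel (a + c) (b + c) := by
  obtain ⟨a1, a2⟩ := a
  obtain ⟨b1, b2⟩ := b
  obtain ⟨c1, c2⟩ := c
  rw [rel_iff] at *
  simp only [add_fst, add_snd, Tmax.add_eq_max, TmaxPair.ext_iff] at *
  grind

theorem rel_neg {a b : TmaxPair Γ} (h : Rel a b) : Rel (-a) (-b) := by
  rw [rel_iff] at *
  simp only [neg_fst, neg_snd, TmaxPair.ext_iff] at *
  grind

theorem rel_mul_right {a b : TmaxPair Γ} (c : TmaxPair Γ) (h : Rel a b) :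
    Rel (a * c) (b * c) := by
  -- a pair with dominant first component acts through that component only
  have key : ∀ a1 a2 b2 c1 c2 : Tmax Γ, a2 < a1 → b2 < a1 →
      Rel ((⟨a1, a2⟩ : TmaxPair Γ) * ⟨c1, c2⟩) (⟨a1, b2⟩ * ⟨c1, c2⟩) := by
    intro a1 a2 b2 c1 c2 h1 h2
    have h0 : a1 ≠ 0 := ((Tmax.zero_le' a2).trans_lt h1).ne'
    have m1 := Tmax.mul_le_mul_left' c1 h1.le
    have m2 := Tmax.mul_le_mul_left' c2 h1.le
    have m3 := Tmax.mul_le_mul_left' c1 h2.le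
    have m4 := Tmax.mul_le_mul_left' c2 h2.le
    rw [mul_comm c1, mul_comm c1] at m1 m3
    rw [mul_comm c2, mul_comm c2] at m2 m4
    rw [rel_iff]
    simp only [mul_fst, mul_snd, Tmax.add_eq_max, TmaxPair.ext_iff]
    rcases lt_trichotomy c1 c2 with hc | hc | hc
    · have := Tmax.mul_lt_mul_left' h0 hc
      have hc0 : c2 ≠ 0 := ((Tmax.zero_le' c1).trans_lt hc).ne'
      have n1 := Tmax.mul_lt_mul_left' hc0 h1
      have n2 := Tmax.mul_lt_mul_left' hc0 h2
      rw [mul_comm c2, mul_comm c2] at n1 n2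
      grind
    · subst hc
      grind
    · have := Tmax.mul_lt_mul_left' h0 hc
      have hc0 : c1 ≠ 0 := ((Tmax.zero_le' c2).trans_lt hc).ne'
      have n1 := Tmax.mul_lt_mul_left' hc0 h1
      have n2 := Tmax.mul_lt_mul_left' hc0 h2
      rw [mul_comm c1, mul_comm c1] at n1 n2
      grind
  obtain ⟨a1, a2⟩ := a
  obtain ⟨b1, b2⟩ := b
  obtain ⟨c1, c2⟩ := c
  rcases (rel_iff _ _).1 h with h | ⟨h1, h2, h3⟩ | ⟨h1, h2, h3⟩
  · rw [h]; exact rel_refl _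
  · dsimp only at h1 h2 h3
    subst h3
    exact key _ _ _ _ _ h1 h2
  · dsimp only at h1 h2 h3
    subst h3
    have := rel_neg (key a2 a1 b1 c1 c2 h1 h2)
    have e : ∀ x y : Tmax Γ, -((⟨y, x⟩ : TmaxPair Γ) * ⟨c1, c2⟩) = ⟨x, y⟩ * ⟨c1, c2⟩ := by
      intro x y
      ext <;> simp [add_comm]
    rwa [e, e] at this

theorem balances_congr {a b a' b' : TmaxPair Γ} (h : Rel a a') (h' : Rel b b') :
    Balances a b ↔ Balances a' b' := by
  have main : ∀ {a b a' b' : TmaxPair Γ}, Rel a a' → Rel b b' → Balances a b →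
      Balances a' b' := by
    intro a b a' b' h h' hb
    obtain ⟨a1, a2⟩ := a
    obtain ⟨b1, b2⟩ := b
    obtain ⟨c1, c2⟩ := a'
    obtain ⟨d1, d2⟩ := b'
    rw [rel_iff] at h h'
    simp only [Balances, Tmax.add_eq_max, TmaxPair.ext_iff] at *
    grind
  exact ⟨main h h', main (rel_symm h) (rel_symm h')⟩

variable (Γ) in
/-- `R` as a congruence of the semiring `T_max²`. -/
def relCon : RingCon (TmaxPair Γ) where
  r := Rel
  iseqv := ⟨rel_refl, rel_symm, rel_trans⟩
  add' {w x y z} h h' := by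
    refine rel_trans (rel_add_right y h) ?_
    rw [add_comm x y, add_comm x z]
    exact rel_add_right x h'
  mul' {w x y z} h h' := by
    refine rel_trans (rel_mul_right y h) ?_
    rw [mul_comm x y, mul_comm x z]
    exact rel_mul_right x h'

end TmaxPair

/-- The symmetrized tropical semiring `S_max(Γ) = T_max² / R`. -/
def Smax (Γ : Type*) [AddCommGroup Γ] [LinearOrder Γ] [IsOrderedAddMonoid Γ] : Type _ :=
  (TmaxPair.relCon Γ).Quotient

namespace Smax

variable {Γ : Type*} [AddCommGroup Γ] [LinearOrder Γ] [IsOrderedAddMonoid Γ]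

instance instCommSemiring : CommSemiring (Smax Γ) :=
  inferInstanceAs (CommSemiring (TmaxPair.relCon Γ).Quotient)

/-- The class of the pair `(a, b)`. -/
def mk (a b : Tmax Γ) : Smax Γ := (TmaxPair.relCon Γ).mk' ⟨a, b⟩

/-- The minus operator `⊖`, induced by `(a₁, a₂) ↦ (a₂, a₁)`; `a ⊖ b` is `a + -b`. -/
instance instNeg : Neg (Smax Γ) :=
  ⟨Quotient.map (fun a : TmaxPair Γ => -a) (fun _ _ h => TmaxPair.rel_neg h)⟩

/-- The balance relation `∇`, induced by the one of `T_max²`. -/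
def Balances (x y : Smax Γ) : Prop :=
  Quotient.liftOn₂ x y TmaxPair.Balances
    (fun _ _ _ _ h h' => propext (TmaxPair.balances_congr h h'))

/-- Signed tropical numbers: the positive, negative or zero elements. -/
def IsSigned (x : Smax Γ) : Prop := ∃ c : Tmax Γ, x = mk c 0 ∨ x = mk 0 c

open Polynomial in
/-- `a` is a root of the formal polynomial `P`: `P̂(a) ∇ 0`. -/
def IsRoot (P : (Smax Γ)[X]) (a : Smax Γ) : Prop := Balances (P.eval a) 0

open Polynomial in
/-- `Q` is a formal quotient of `P` by `Y ⊖ a`: `Q` has signed coefficients and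
`λ P ∇ (Y ⊖ a) Q` coefficientwise, for some nonzero signed `λ`. -/
def IsQuotient (a : Smax Γ) (P Q : (Smax Γ)[X]) : Prop :=
  (∀ i, IsSigned (Q.coeff i)) ∧ ∃ l : Smax Γ, IsSigned l ∧ l ≠ 0 ∧
    ∀ i, Balances ((C l * P).coeff i) (((X + C (-a)) * Q).coeff i)

open Polynomial in
/-- `MultGE a m P` says that the recursion for the multiplicity of `a` in `P` can be run for at
least `m` steps. -/
def MultGE (a : Smax Γ) : ℕ → (Smax Γ)[X] → Prop
  | 0, _ => True
  | m + 1, P => IsRoot P a ∧ (m = 0 ∨ ∃ Q, IsQuotient a P Q ∧ MultGE a m Q)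

open Polynomial in
/-- The multiplicity of `a` as a root of `P` (`⊤` if the recursion never ends, as for `P = 0`).
The recursion that characterizes it is `mult_eq`. -/
noncomputable def mult (a : Smax Γ) (P : (Smax Γ)[X]) : ℕ∞ :=
  ⨆ (m : ℕ) (_ : MultGE a m P), (m : ℕ∞)

open Polynomial in
open Classical in
/-- The defining recursion of the multiplicity: it is `0` if `a` is not a root of `P`, and
`1 + max {mult_a(Q)}` over the quotients `Q` if `a` is a root of `P`. -/
theorem mult_eq (a : Smax Γ) (P : (Smax Γ)[X]) :
    mult a P = if IsRoot P a then 1 + ⨆ (Q : (Smax Γ)[X]) (_ : IsQuotient a P Q), mult a Q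
      else 0 := by
  split_ifs with h
  · apply le_antisymm
    · refine iSup₂_le fun m hm => ?_
      cases m with
      | zero => simp
      | succ m =>
        rw [Nat.cast_succ, add_comm]
        refine add_le_add le_rfl ?_
        rcases hm.2 with rfl | ⟨Q, hQ, hm⟩
        · simp
        · exact le_iSup₂_of_le Q hQ (le_iSup₂_of_le m hm le_rfl)
    · have h1 : (1 : ℕ∞) ≤ mult a P := le_iSup₂_of_le 1 ⟨h, Or.inl rfl⟩ (by simp)
      have hs : (⨆ (Q : (Smax Γ)[X]) (_ : IsQuotient a P Q), mult a Q) ≤ mult a P - 1 := by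
        refine iSup₂_le fun Q hQ => iSup₂_le fun m hm => ?_
        refine ENat.le_sub_of_add_le_left (by simp) ?_
        rw [add_comm]
        exact le_iSup₂_of_le (m + 1) ⟨h, Or.inr ⟨Q, hQ, hm⟩⟩ (by simp)
      calc _ ≤ 1 + (mult a P - 1) := add_le_add le_rfl hs
        _ = mult a P := add_tsub_cancel_of_le h1
  · refine le_antisymm (iSup₂_le fun m hm => ?_) (by simp)
    cases m with
    | zero => simp
    | succ m => exact absurd hm.1 h

end Smax

set_option linter.unusedSectionVars false

/-! ### Order, cancellation and powers in the tropical semifield -/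

namespace Tmax

variable {Γ : Type*} [AddCommGroup Γ] [LinearOrder Γ] [IsOrderedAddMonoid Γ]

/-! Write |x| for `abs x`. For a modulus c ≠ ⊥, the monomials of P that are maximal at |y| = c have
extreme indices lo ≤ hi (`IsEdge`): this is the edge of the Newton polygon of P at c. By
`IsDominant.le_of_lt` the intervals [lo, hi) of different c are disjoint and ordered, and they all
lie in [0, n).

Descartes' rule bounds the roots on an edge. Multiplicity at least m for a ≠ 0 forces m + 1 dominant
terms of alternating sign among the P_k a^k (`MultGE.exists_alt`), because multiplication by Y ⊖ a
creates at least one new alternation (`Alt.of_balances`). For ⊖a the terms are twisted by (⊖1)^k.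
Between neighbouring dominant indices exactly one of the two sequences changes sign, and across a
gap the skipped indices pay for a change in both (`Alt.add_le`). Hence mult a + mult (⊖a) ≤ hi − lo
(`IsEdge.add_le`). As there are n roots and only n places, every such bound is an equality
(`card_filter_eq_of_intervals`, `IsEdge.card_eq`).

Equality fixes the signs at the ends of each edge: P_lo is P_hi times the product of the ⊖r_i with
|r_i| = c. Telescoping from P_n gives the coefficient at every vertex (`IsEdge.coeff_left`,
`IsEdge.coeff_right`). At y ≠ 0, roots larger than y contribute ⊖r_i to the product and smaller ones
contribute y, so both sides reduce to the edge at |y|. For signed y, the factors with |r_i| = |y|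
give y^(hi − lo), times 1 ⊖ 1 exactly when y is a root, which is when dominant terms of both signs
occur in P̂(y). Balanced y follow from absorption, and y = 0 from the value of P_0. -/

theorem add_self (a : Tmax Γ) : a + a = a := max_self a

theorem pos_iff {a : Tmax Γ} : 0 < a ↔ a ≠ 0 := WithBot.bot_lt_iff_ne_bot (α := Γ)

theorem exists_mul_eq_one {a : Tmax Γ} (h : a ≠ 0) : ∃ b : Tmax Γ, a * b = 1 := by
  obtain ⟨g, hg⟩ := WithBot.ne_bot_iff_exists (α := Γ).1 h
  refine ⟨((-g : Γ) : WithBot Γ), ?_⟩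
  rw [← hg]
  change ((g : WithBot Γ) + ((-g : Γ) : WithBot Γ)) = ((0 : Γ) : WithBot Γ)
  rw [← WithBot.coe_add, add_neg_cancel]

theorem one_ne_zero' : (1 : Tmax Γ) ≠ 0 := WithBot.coe_ne_bot (α := Γ)

theorem mul_ne_zero' {a b : Tmax Γ} (ha : a ≠ 0) (hb : b ≠ 0) : a * b ≠ 0 := by
  have := mul_lt_mul_left' ha (pos_iff.2 hb)
  rw [mul_zero] at this
  exact pos_iff.1 this

theorem pow_ne_zero' {a : Tmax Γ} (ha : a ≠ 0) (k : ℕ) : a ^ k ≠ 0 := by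
  induction k with
  | zero => rw [pow_zero]; exact one_ne_zero'
  | succ k ih => rw [pow_succ]; exact mul_ne_zero' ih ha

theorem le_of_mul_le_mul_left' {a b c : Tmax Γ} (hc : c ≠ 0) (h : c * a ≤ c * b) : a ≤ b :=
  not_lt.1 fun h' => (mul_lt_mul_left' hc h').not_ge h

theorem mul_le_mul'' {a b c d : Tmax Γ} (h : a ≤ b) (h' : c ≤ d) : a * c ≤ b * d :=
  (mul_le_mul_left' a h').trans (by
    rw [mul_comm a, mul_comm b]; exact mul_le_mul_left' d h)

theorem pow_le_pow' {a b : Tmax Γ} (h : a ≤ b) (k : ℕ) : a ^ k ≤ b ^ k := by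
  induction k with
  | zero => simp
  | succ k ih => rw [pow_succ, pow_succ]; exact mul_le_mul'' ih h

theorem pow_lt_pow' {a b : Tmax Γ} (h : a < b) {k : ℕ} (hk : k ≠ 0) : a ^ k < b ^ k := by
  obtain ⟨k, rfl⟩ := Nat.exists_eq_succ_of_ne_zero hk
  have hb : b ≠ 0 := pos_iff.1 ((zero_le' a).trans_lt h)
  rw [Nat.succ_eq_add_one, pow_succ, pow_succ]
  refine (mul_le_mul'' (pow_le_pow' h.le k) le_rfl).trans_lt ?_
  exact mul_lt_mul_left' (pow_ne_zero' hb k) h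

end Tmax

/-! ### Absolute value, signs and balances in the symmetrized semiring -/

namespace Smax

variable {Γ : Type*} [AddCommGroup Γ] [LinearOrder Γ] [IsOrderedAddMonoid Γ]

theorem exists_mk (x : Smax Γ) : ∃ a b, x = mk a b := by
  induction x using Quotient.ind with
  | _ p => exact ⟨p.fst, p.snd, rfl⟩

theorem mk_eq_mk {a b c d : Tmax Γ} :
    mk a b = mk c d ↔ TmaxPair.Rel ⟨a, b⟩ ⟨c, d⟩ :=
  Quotient.eq (r := (TmaxPair.relCon Γ).toSetoid)

theorem zero_def : (0 : Smax Γ) = mk 0 0 := rfl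
theorem one_def : (1 : Smax Γ) = mk 1 0 := rfl
theorem mk_add (a b c d : Tmax Γ) : mk a b + mk c d = mk (a + c) (b + d) := rfl
theorem mk_mul (a b c d : Tmax Γ) :
    mk a b * mk c d = mk (a * c + b * d) (a * d + b * c) := rfl
theorem neg_mk (a b : Tmax Γ) : -mk a b = mk b a := rfl
theorem balances_mk {a b c d : Tmax Γ} :
    Balances (mk a b) (mk c d) ↔ a + d = b + c := Iff.rfl

/-- The absolute value of the class of `(a, b)` is `a ⊕ b`. -/
def abs : Smax Γ →+* Tmax Γ :=
  (TmaxPair.relCon Γ).lift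
    { toFun := fun p => p.fst + p.snd
      map_one' := by simp
      map_zero' := by simp
      map_add' := fun p q => by simp; ring
      map_mul' := fun p q => by simp; ring }
    (by
      intro p q h
      rcases (TmaxPair.rel_iff p q).1 h with rfl | ⟨h1, h2, h3⟩ | ⟨h1, h2, h3⟩
      · rfl
      · change p.fst + p.snd = q.fst + q.snd
        rw [Tmax.add_eq_max, Tmax.add_eq_max, max_eq_left h1.le, max_eq_left h2.le, h3]
      · change p.fst + p.snd = q.fst + q.snd
        rw [Tmax.add_eq_max, Tmax.add_eq_max, max_eq_right h1.le, max_eq_right h2.le, h3])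

theorem abs_mk (a b : Tmax Γ) : abs (mk a b) = a + b := rfl

/-- The element `⊖ 1`. -/
def e : Smax Γ := mk 0 1

/-- Turning ⊖ into a multiplication makes sign manipulations accessible to `ring`, although ⊖ is not
an additive inverse. -/
theorem neg_eq (x : Smax Γ) : -x = e * x := by
  obtain ⟨a, b, rfl⟩ := exists_mk x
  simp [neg_mk, e, mk_mul]

theorem e_mul_e : (e : Smax Γ) * e = 1 := by simp [e, mk_mul, one_def]

theorem e_mul_e_mul (x : Smax Γ) : e * (e * x) = x := by rw [← mul_assoc, e_mul_e, one_mul]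

theorem abs_e : abs (e : Smax Γ) = 1 := by simp [e, abs_mk]

theorem abs_e_mul (x : Smax Γ) : abs (e * x) = abs x := by simp [abs_e]

theorem add_self (x : Smax Γ) : x + x = x := by
  obtain ⟨a, b, rfl⟩ := exists_mk x
  simp [mk_add, Tmax.add_self]

theorem abs_eq_zero {x : Smax Γ} : abs x = 0 ↔ x = 0 := by
  refine ⟨fun h => ?_, fun h => by simp [h]⟩
  obtain ⟨a, b, rfl⟩ := exists_mk x
  rw [abs_mk, Tmax.add_eq_max] at h
  have ha : a = 0 := le_antisymm (h ▸ le_max_left a b) (Tmax.zero_le' _)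
  have hb : b = 0 := le_antisymm (h ▸ le_max_right a b) (Tmax.zero_le' _)
  rw [ha, hb, zero_def]

theorem add_eq_right_of_abs_lt {x y : Smax Γ} (h : abs x < abs y) : x + y = y := by
  obtain ⟨a, b, rfl⟩ := exists_mk x
  obtain ⟨c, d, rfl⟩ := exists_mk y
  rw [abs_mk, abs_mk] at h
  rw [mk_add, mk_eq_mk, TmaxPair.rel_iff]
  simp only [Tmax.add_eq_max, TmaxPair.ext_iff] at *
  grind

theorem isSigned_e : IsSigned (e : Smax Γ) := ⟨1, Or.inr rfl⟩
theorem isSigned_one : IsSigned (1 : Smax Γ) := ⟨1, Or.inl rfl⟩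
theorem isSigned_zero : IsSigned (0 : Smax Γ) := ⟨0, Or.inl rfl⟩

theorem IsSigned.mul {x y : Smax Γ} (hx : IsSigned x) (hy : IsSigned y) : IsSigned (x * y) := by
  obtain ⟨c, rfl | rfl⟩ := hx <;> obtain ⟨d, rfl | rfl⟩ := hy <;> refine ⟨c * d, ?_⟩ <;>
    simp [mk_mul]

theorem IsSigned.pow {x : Smax Γ} (hx : IsSigned x) (k : ℕ) : IsSigned (x ^ k) := by
  induction k with
  | zero => rw [pow_zero]; exact isSigned_one
  | succ k ih => rw [pow_succ]; exact ih.mul hx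

theorem IsSigned.eq_or_eq_of_abs_eq {x y : Smax Γ} (hx : IsSigned x) (hy : IsSigned y)
    (h : abs x = abs y) : x = y ∨ x = e * y := by
  obtain ⟨c, rfl | rfl⟩ := hx <;> obtain ⟨d, rfl | rfl⟩ := hy <;>
    simp only [abs_mk, zero_add, add_zero] at h <;> simp [e, mk_mul, h]

theorem IsSigned.ne_e_mul {x : Smax Γ} (hx : IsSigned x) (h : x ≠ 0) : x ≠ e * x := by
  intro h'
  apply h
  obtain ⟨c, rfl | rfl⟩ := hx <;> simp only [e, mk_mul, mk_eq_mk, TmaxPair.rel_iff] at h' <;>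
    simp [TmaxPair.ext_iff] at h' <;> rw [zero_def] <;> grind

theorem exists_isSigned_mul_eq_one {x : Smax Γ} (hx : IsSigned x) (h : x ≠ 0) :
    ∃ y, IsSigned y ∧ x * y = 1 := by
  have h0 : abs x ≠ 0 := fun h' => h (abs_eq_zero.1 h')
  obtain ⟨c, rfl | rfl⟩ := hx
  · obtain ⟨d, hd⟩ := Tmax.exists_mul_eq_one (a := c) (by simpa [abs_mk] using h0)
    exact ⟨mk d 0, ⟨d, Or.inl rfl⟩, by simp [mk_mul, hd, one_def]⟩
  · obtain ⟨d, hd⟩ := Tmax.exists_mul_eq_one (a := c) (by simpa [abs_mk] using h0)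
    exact ⟨mk 0 d, ⟨d, Or.inr rfl⟩, by simp [mk_mul, hd, one_def]⟩

theorem IsSigned.mul_left_cancel {x y z : Smax Γ} (hx : IsSigned x) (h : x ≠ 0)
    (hyz : x * y = x * z) : y = z := by
  obtain ⟨w, -, hw⟩ := exists_isSigned_mul_eq_one hx h
  rw [← one_mul y, ← one_mul z, ← hw, mul_comm x, mul_assoc, mul_assoc, hyz]

theorem abs_ne_zero {x : Smax Γ} (h : x ≠ 0) : abs x ≠ 0 := fun h' => h (abs_eq_zero.1 h')

theorem Balances.mul_left {x y : Smax Γ} (h : Balances x y) (z : Smax Γ) :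
    Balances (z * x) (z * y) := by
  obtain ⟨a, b, rfl⟩ := exists_mk x
  obtain ⟨c, d, rfl⟩ := exists_mk y
  obtain ⟨u, v, rfl⟩ := exists_mk z
  rw [balances_mk] at h
  simp only [mk_mul, balances_mk]
  calc u * a + v * b + (u * d + v * c) = u * (a + d) + v * (b + c) := by ring
    _ = u * (b + c) + v * (a + d) := by rw [h]
    _ = _ := by ring

/-- The balance relation is not transitive in general; between signed elements it is rigid, which is
how coefficientwise balances yield actual values. -/
theorem Balances.eq {x y : Smax Γ} (h : Balances x y) (hx : IsSigned x) (hy : IsSigned y) :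
    x = y := by
  obtain ⟨c, rfl | rfl⟩ := hx <;> obtain ⟨d, rfl | rfl⟩ := hy <;>
    simp only [balances_mk, Tmax.add_eq_max] at h <;>
    rw [mk_eq_mk, TmaxPair.rel_iff] <;> simp only [TmaxPair.ext_iff]
  all_goals
    have h1 := Tmax.zero_le' c
    have h2 := Tmax.zero_le' d
    grind

theorem Balances.abs_le {x y : Smax Γ} (h : Balances x y) (hx : IsSigned x) :
    abs x ≤ abs y := by
  obtain ⟨a, b, rfl⟩ := exists_mk y
  obtain ⟨c, rfl | rfl⟩ := hx <;>
    simp only [balances_mk, abs_mk, Tmax.add_eq_max] at * <;>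
    have h1 := Tmax.zero_le' a <;> have h2 := Tmax.zero_le' b <;> have h3 := Tmax.zero_le' c <;>
    grind

theorem IsSigned.add_e_mul_eq {x y : Smax Γ} (hx : IsSigned x) (hy : IsSigned y) (hxy : y ≠ x)
    (h : abs y ≤ abs x) : x + e * y = x := by
  rcases h.lt_or_eq with h | h
  · rw [add_comm]; exact add_eq_right_of_abs_lt (by rwa [abs_e_mul])
  · rcases hy.eq_or_eq_of_abs_eq hx h with rfl | rfl
    · exact absurd rfl hxy
    · rw [e_mul_e_mul, add_self]

theorem IsSigned.not_balances_zero {x : Smax Γ} (hx : IsSigned x) (h : x ≠ 0) :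
    ¬ Balances x 0 := fun h' => h (h'.eq hx isSigned_zero)

theorem one_add_e_mul_e : (e : Smax Γ) * (1 + e) = 1 + e := by
  rw [mul_add, e_mul_e, mul_one, add_comm]

theorem one_add_e_sq : (1 + e : Smax Γ) * (1 + e) = 1 + e := by
  rw [add_mul, one_mul, one_add_e_mul_e, add_self]

theorem abs_one_add_e : abs (1 + e : Smax Γ) = 1 := by simp [abs_e, Tmax.add_self]

/-- If the components differ, only the larger one counts modulo the relation; if they agree, the
class is x ⊖ x. The theorem is checked separately on these two kinds of points. -/
theorem isSigned_or_balanced (y : Smax Γ) :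
    IsSigned y ∨ ∃ x, IsSigned x ∧ x ≠ 0 ∧ y = x * (1 + e) := by
  obtain ⟨a, b, rfl⟩ := exists_mk y
  have ha := Tmax.zero_le' a
  have hb := Tmax.zero_le' b
  rcases lt_trichotomy a b with h | rfl | h
  · left; refine ⟨b, Or.inr ?_⟩
    rw [mk_eq_mk, TmaxPair.rel_iff]; simp only [TmaxPair.ext_iff]; grind
  · by_cases h : a = 0
    · left; subst h; exact isSigned_zero
    · right
      refine ⟨mk a 0, ⟨a, Or.inl rfl⟩, fun h' => h ?_, by simp [e, one_def, mk_mul, mk_add]⟩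
      simpa [abs_mk] using congrArg abs h'
  · left; refine ⟨a, Or.inl ?_⟩
    rw [mk_eq_mk, TmaxPair.rel_iff]; simp only [TmaxPair.ext_iff]; grind

/-- `x ⊖ x` absorbs everything that is not larger in absolute value. -/
theorem IsSigned.add_balanced {x : Smax Γ} (hx : IsSigned x) {z : Smax Γ} (h : abs z ≤ abs x) :
    z + x * (1 + e) = x * (1 + e) := by
  obtain ⟨a, b, rfl⟩ := exists_mk z
  obtain ⟨c, rfl | rfl⟩ := hx <;>
    simp only [abs_mk, one_def, e, mk_mul, mk_add] at * <;>
    simp only [zero_add, add_zero, mul_one, Tmax.add_eq_max, mk_eq_mk,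
      TmaxPair.rel_iff, TmaxPair.ext_iff] at * <;> grind

/-! ### Sums determined by their dominant terms -/

theorem sum_eq_of_absorb {ι : Type*} {s : Finset ι} {f : ι → Smax Γ} {z : Smax Γ}
    (h : ∀ i ∈ s, f i + z = z) : ∑ i ∈ s, f i + z = z := by
  classical
  induction s using Finset.induction_on with
  | empty => simp
  | insert a s ha ih =>
    rw [Finset.sum_insert ha, add_assoc, ih fun i hi => h i (Finset.mem_insert_of_mem hi)]
    exact h a (Finset.mem_insert_self a s)

theorem sum_add_mem {ι : Type*} {s : Finset ι} {f : ι → Smax Γ} {i : ι} (hi : i ∈ s) :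
    ∑ i ∈ s, f i + f i = ∑ i ∈ s, f i := by
  classical
  rw [← Finset.add_sum_erase s f hi, add_comm (f i), add_assoc, add_self]

theorem sum_eq_of_mem {ι : Type*} {s : Finset ι} {f : ι → Smax Γ} {z : Smax Γ}
    (h : ∀ i ∈ s, f i + z = z) {i : ι} (hi : i ∈ s) (hz : f i = z) : ∑ i ∈ s, f i = z := by
  rw [← sum_add_mem hi, hz, sum_eq_of_absorb h]

/-- Addition is idempotent, so the terms x and ⊖x may be added once more; x ⊖ x then absorbs the
whole sum. -/
theorem sum_eq_balanced {ι : Type*} {s : Finset ι} {f : ι → Smax Γ} {x : Smax Γ}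
    (hx : IsSigned x) (h : ∀ i ∈ s, abs (f i) ≤ abs x) {i j : ι} (hi : i ∈ s) (hj : j ∈ s)
    (hfi : f i = x) (hfj : f j = e * x) : ∑ i ∈ s, f i = x * (1 + e) := by
  rw [← sum_add_mem hi, ← sum_add_mem hj, add_assoc, hfi, hfj, mul_add, mul_one, mul_comm x,
    add_comm (e * x)]
  have := sum_eq_of_absorb (z := x * (1 + e)) fun i hi => hx.add_balanced (h i hi)
  rwa [mul_add, mul_one, mul_comm x] at this

/-! ### Sign alternations and Descartes' rule -/

/-- `Alt T x s h`: there are `s` indices below `h` along which `T` takes, from the largest index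
to the smallest one, the values `x, ⊖ x, x, …`. -/
def Alt (T : ℕ → Smax Γ) : Smax Γ → ℕ → ℕ → Prop
  | _, 0, _ => True
  | x, s + 1, h => ∃ k < h, T k = x ∧ Alt T (e * x) s k

theorem Alt.mono {T : ℕ → Smax Γ} {x : Smax Γ} {s h h' : ℕ} (H : Alt T x s h) (hh : h ≤ h') :
    Alt T x s h' := by
  cases s with
  | zero => trivial
  | succ s =>
    obtain ⟨k, hk, hx⟩ := H
    exact ⟨k, hk.trans_le hh, hx⟩

theorem Alt.of_succ {T : ℕ → Smax Γ} {x : Smax Γ} {s h : ℕ} (H : Alt T x s (h + 1))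
    (hx : T h ≠ x) : Alt T x s h := by
  cases s with
  | zero => trivial
  | succ s =>
    obtain ⟨k, hk, hkx, hs⟩ := H
    exact ⟨k, (Nat.lt_succ_iff_lt_or_eq.1 hk).resolve_right (by rintro rfl; exact hx hkx), hkx, hs⟩

/-- A chain whose smallest term differs from the first extreme term of the sequence extends
downwards. -/
theorem Alt.extend_below {T : ℕ → Smax Γ} {x : Smax Γ} {lo : ℕ} (hx : IsSigned x) (h0 : x ≠ 0)
    (hlo : ∀ k, T k = x ∨ T k = e * x → lo ≤ k) {s h : ℕ} (H : Alt T x (s + 1) h)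
    (h' : T lo = e ^ (s + 1) * x) : Alt T x (s + 2) h := by
  induction s generalizing x h with
  | zero =>
    obtain ⟨k, hk, hkx, -⟩ := H
    rw [zero_add, pow_one] at h'
    refine ⟨k, hk, hkx, lo, lt_of_le_of_ne (hlo k (Or.inl hkx)) ?_, h', trivial⟩
    rintro rfl
    exact hx.ne_e_mul h0 (hkx.symm.trans h')
  | succ s ih =>
    obtain ⟨k, hk, hkx, hs⟩ := H
    refine ⟨k, hk, hkx, ih (isSigned_e.mul hx) (fun h => h0 ?_) (fun k hk => hlo k ?_) hs ?_⟩
    · rw [← e_mul_e_mul x, h, mul_zero]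
    · rw [e_mul_e_mul] at hk; exact hk.symm
    · rw [h', pow_succ, mul_assoc]

/-- Descartes' bound: the alternations of `T` and of `k ↦ (⊖ 1)^k T k` together are at most as many
as the distance of the extreme terms allows. -/
theorem Alt.add_le {T : ℕ → Smax Γ} {x : Smax Γ} {lo : ℕ} (hx : IsSigned x) (h0 : x ≠ 0)
    (hlo : ∀ k, T k = x ∨ T k = e * x → lo ≤ k) {h : ℕ} (hh : lo ≤ h)
    {y z : Smax Γ} (hy : y = x ∨ y = e * x) (hz : z = x ∨ z = e * x) {s t : ℕ}
    (Hs : Alt T y s (h + 1)) (Ht : Alt (fun k => e ^ k * T k) z t (h + 1)) :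
    s + t + lo ≤ h + 2 ∧ (¬ (T h = x ∨ T h = e * x) → s + t + lo ≤ h + 1) := by
  have hpow : ∀ k : ℕ, (e : Smax Γ) ^ k = 1 ∨ (e : Smax Γ) ^ k = e := by
    intro k
    induction k with
    | zero => simp
    | succ k ih =>
      rcases ih with ih | ih <;> rw [pow_succ, ih]
      · right; rw [one_mul]
      · left; rw [e_mul_e]
  -- The twist by (⊖1)^k keeps the set of indices with value x or ⊖x.
  have hsupp : ∀ k, ∀ w, w = x ∨ w = e * x → e ^ k * T k = w → T k = x ∨ T k = e * x := by
    intro k w hw hk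
    have : T k = e ^ k * w := by
      rw [← hk]
      rcases hpow k with h | h <;> rw [h]
      · simp
      · rw [e_mul_e_mul]
    rcases hpow k with h | h <;> rw [h] at this <;> rcases hw with rfl | rfl
    · left; simpa using this
    · right; simpa using this
    · right; exact this
    · left; rw [this, e_mul_e_mul]
  have hneg : ∀ w, w = x ∨ w = e * x → e * w = x ∨ e * w = e * x := by
    rintro w (rfl | rfl)
    · exact Or.inr rfl
    · left; exact e_mul_e_mul _
  have hone : ∀ {y : Smax Γ} {s h : ℕ}, (∀ k < h, ¬ (T k = x ∨ T k = e * x)) →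
      (y = x ∨ y = e * x) → Alt T y s h → s = 0 := by
    intro y s h hk hy H
    cases s with
    | zero => rfl
    | succ s =>
      obtain ⟨k, hkh, rfl, -⟩ := H
      exact absurd hy (hk k hkh)
  have hone' : ∀ {y : Smax Γ} {s h : ℕ}, (∀ k < h, ¬ (T k = x ∨ T k = e * x)) →
      (y = x ∨ y = e * x) → Alt (fun k => e ^ k * T k) y s h → s = 0 := by
    intro y s h hk hy H
    cases s with
    | zero => rfl
    | succ s =>
      obtain ⟨k, hkh, hky, -⟩ := H
      exact absurd (hsupp k y hy hky) (hk k hkh)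
  -- The bound that is better by one when h is not an extreme index is carried along: it pays for
  -- both chains growing right after a gap.
  induction h, hh using Nat.le_induction generalizing y z s t with
  | base =>
    have hlt : ∀ k < lo, ¬ (T k = x ∨ T k = e * x) := fun k hk h => (hlo k h).not_gt hk
    constructor
    · have h1 : s ≤ 1 := by
        rcases s with _ | s
        · omega
        obtain ⟨k, hk, rfl, H⟩ := Hs
        have := hone (fun j hj => hlt j (by omega)) (hneg _ hy) H
        omega
      have h2 : t ≤ 1 := by
        rcases t with _ | t
        · omega
        obtain ⟨k, hk, hkz, H⟩ := Ht
        have := hone' (fun j hj => hlt j (by omega)) (hneg _ hz) H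
        omega
      omega
    · intro hn
      have hlt' : ∀ k < lo + 1, ¬ (T k = x ∨ T k = e * x) := fun k hk =>
        (Nat.lt_succ_iff_lt_or_eq.1 hk).elim (hlt k) (by rintro rfl; exact hn)
      have := hone hlt' hy Hs
      have := hone' hlt' hz Ht
      omega
  | succ h hh ih =>
    by_cases hT : T (h + 1) = x ∨ T (h + 1) = e * x
    · refine ⟨?_, fun hn => absurd hT hn⟩
      -- shrink a chain by at most one term, and by none if the two last terms agree
      have shrink : ∀ (S : ℕ → Smax Γ) (w : Smax Γ) (u : ℕ), (w = x ∨ w = e * x) →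
          Alt S w u (h + 1 + 1) →
          ∃ w' u', (w' = x ∨ w' = e * x) ∧ Alt S w' u' (h + 1) ∧ u ≤ u' + 1 ∧
            (S h = S (h + 1) → u ≤ u') := by
        intro S w u hw H
        rcases u with _ | u
        · exact ⟨w, 0, hw, trivial, by omega, fun _ => le_rfl⟩
        obtain ⟨k, hk, hkw, H⟩ := H
        rcases Nat.lt_succ_iff_lt_or_eq.1 hk with hk' | rfl
        · exact ⟨w, u + 1, hw, ⟨k, hk', hkw, H⟩, by omega, fun _ => le_rfl⟩
        by_cases hS : S h = S (h + 1)
        · refine ⟨w, u + 1, hw, ⟨h, by omega, hS.trans hkw, H.of_succ ?_⟩, by omega,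
            fun _ => le_rfl⟩
          rw [hS, hkw]
          rcases hw with rfl | rfl
          · exact hx.ne_e_mul h0
          · rw [e_mul_e_mul]; exact (hx.ne_e_mul h0).symm
        · exact ⟨e * w, u, hneg w hw, H, le_rfl, fun h => absurd h hS⟩
      obtain ⟨y', s', hy', Hs', hs1, hs2⟩ := shrink T y s hy Hs
      obtain ⟨z', t', hz', Ht', ht1, ht2⟩ := shrink _ z t hz Ht
      obtain ⟨i1, i2⟩ := ih hy' hz' Hs' Ht'
      -- If h and h + 1 are both extreme, equal values stop the chain of T from growing and opposite
      -- values stop the twisted one.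
      by_cases hT' : T h = x ∨ T h = e * x
      · by_cases hS : T h = T (h + 1)
        · have := hs2 hS
          omega
        · have : T h = e * T (h + 1) := by
            rcases hT with h1 | h1 <;> rcases hT' with h2 | h2 <;> first
              | exact absurd (h2.trans h1.symm) hS
              | rw [h1, h2, e_mul_e_mul]
              | rw [h1, h2]
          have := ht2 (by rw [this, pow_succ, mul_assoc])
          omega
      · have := i2 hT'
        omega
    · have Hs' := Hs.of_succ (fun h => hT (h ▸ hy))
      have Ht' := Ht.of_succ (fun h => hT (hsupp _ z hz h))
      have := (ih hy hz Hs' Ht').1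
      exact ⟨by omega, fun _ => by omega⟩

/-- Descartes' step: a formal quotient by `Y ⊖ a` has fewer alternations. -/
theorem Alt.of_balances {U V : ℕ → Smax Γ} {b x : Smax Γ} (hU : ∀ k, IsSigned (U k))
    (hV : ∀ k, IsSigned (V k)) (hb : IsSigned b) (hx : IsSigned x) (h0 : x ≠ 0)
    (hmax : ∀ k, abs (U k) ≤ abs x)
    (hbal0 : Balances (V 0) (b * (e * U 0)))
    (hbal : ∀ k, Balances (V (k + 1)) (b * (U k + e * U (k + 1)))) {s h : ℕ}
    (H : Alt U x (s + 1) h) (hh : U h ≠ x) : Alt V (b * x) (s + 2) (h + 1) := by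
  -- Here j − 1 is the last index below h where U equals x; there x ⊖ U_j = x.
  have up : ∀ x, IsSigned x → (∀ k, abs (U k) ≤ abs x) → ∀ h k, k < h → U k = x → U h ≠ x →
      ∃ j, k < j ∧ j ≤ h ∧ V j = b * x := by
    intro x hx hmax h k hk hkx hh
    induction h, hk using Nat.le_induction with
    | base =>
      refine ⟨k + 1, by omega, le_rfl, ?_⟩
      have := hbal k
      rw [hkx, hx.add_e_mul_eq (hU _) hh (hmax _)] at this
      exact this.eq (hV _) (hb.mul hx)
    | succ h hk ih =>
      by_cases h' : U h = x
      · refine ⟨h + 1, by omega, le_rfl, ?_⟩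
        have := hbal h
        rw [h', hx.add_e_mul_eq (hU _) hh (hmax _)] at this
        exact this.eq (hV _) (hb.mul hx)
      · obtain ⟨j, hj, hj', hjx⟩ := ih h'
        exact ⟨j, hj, by omega, hjx⟩
  -- The index j is the bottom of the run of values x ending at k; just below it, or at index 0,
  -- nothing cancels ⊖x.
  have down : ∀ x, IsSigned x → (∀ k, abs (U k) ≤ abs x) → ∀ k, U k = x →
      ∃ j ≤ k, V j = b * (e * x) := by
    intro x hx hmax k hkx
    induction k with
    | zero =>
      refine ⟨0, le_rfl, ?_⟩
      rw [hkx] at hbal0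
      exact hbal0.eq (hV 0) (hb.mul (isSigned_e.mul hx))
    | succ k ih =>
      by_cases h' : U k = x
      · obtain ⟨j, hj, hjx⟩ := ih h'
        exact ⟨j, by omega, hjx⟩
      · refine ⟨k + 1, le_rfl, ?_⟩
        have h2 : U k + e * x = e * x := by
          have := congrArg (e * ·) (hx.add_e_mul_eq (hU k) h' (hmax k))
          simp only [mul_add, e_mul_e_mul] at this
          rw [add_comm, this]
        have := hbal k
        rw [hkx, h2] at this
        exact this.eq (hV _) (hb.mul (isSigned_e.mul hx))
  -- `up` gives one index of V above each term of the chain and not beyond the preceding term;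
  -- `down` adds the extra one below the last term.
  induction s generalizing x h with
  | zero =>
    obtain ⟨k, hk, hkx, -⟩ := H
    obtain ⟨j, hj, hj', hjx⟩ := up x hx hmax h k hk hkx hh
    obtain ⟨i, hi, hix⟩ := down x hx hmax k hkx
    exact ⟨j, by omega, hjx, i, by omega, by rw [hix]; ring, trivial⟩
  | succ s ih =>
    obtain ⟨k, hk, hkx, H⟩ := H
    obtain ⟨j, hj, hj', hjx⟩ := up x hx hmax h k hk hkx hh
    have := ih (isSigned_e.mul hx) (fun h => h0 (by rw [← e_mul_e_mul x, h, mul_zero]))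
      (by simpa only [abs_e_mul] using hmax) H (by rw [hkx]; exact hx.ne_e_mul h0)
    refine ⟨j, by omega, hjx, ?_⟩
    have h2 := this.mono (h' := j) (by omega)
    rwa [show b * (e * x) = e * (b * x) by ring] at h2

theorem Alt.cancel {T : ℕ → Smax Γ} {l x : Smax Γ} (hl : IsSigned l) (h0 : l ≠ 0) {s h : ℕ}
    (H : Alt (fun k => l * T k) (l * x) s h) : Alt T x s h := by
  induction s generalizing x h with
  | zero => trivial
  | succ s ih =>
    obtain ⟨k, hk, hkx, H⟩ := H
    refine ⟨k, hk, hl.mul_left_cancel h0 hkx, ih ?_⟩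
    rwa [show l * (e * x) = e * (l * x) by ring]

/-! ### From multiplicities to alternations -/

open Polynomial

theorem abs_add_le {x y : Smax Γ} {c : Tmax Γ} (hx : abs x ≤ c) (hy : abs y ≤ c) :
    abs (x + y) ≤ c := by
  rw [map_add, Tmax.add_eq_max]; exact max_le hx hy

/-- Terms no larger than `x` and different from `⊖ x` are absorbed by `x`. -/
theorem IsSigned.absorb {x y : Smax Γ} (hx : IsSigned x) (hy : IsSigned y) (hxy : y ≠ e * x)
    (h : abs y ≤ abs x) : y + x = x := by
  have := hx.add_e_mul_eq (isSigned_e.mul hy) (fun h' => hxy (by rw [← h', e_mul_e_mul]))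
    (by rwa [abs_e_mul])
  rwa [e_mul_e_mul, add_comm] at this

theorem exists_dominant {P : (Smax Γ)[X]} (h0 : P ≠ 0) (c : Tmax Γ) :
    ∃ k, P.coeff k ≠ 0 ∧ ∀ j, abs (P.coeff j) * c ^ j ≤ abs (P.coeff k) * c ^ k := by
  obtain ⟨k, hk, hmax⟩ := P.support.exists_max_image (fun k => abs (P.coeff k) * c ^ k)
    (by rwa [Finset.nonempty_iff_ne_empty, Ne, Polynomial.support_eq_empty])
  refine ⟨k, Polynomial.mem_support_iff.1 hk, fun j => ?_⟩
  by_cases hj : P.coeff j = 0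
  · simp only [hj, map_zero, zero_mul]; exact Tmax.zero_le' _
  · exact hmax j (Polynomial.mem_support_iff.2 hj)

theorem pow_ne_zero_of_ne {a : Smax Γ} (h0 : a ≠ 0) (k : ℕ) : a ^ k ≠ 0 := fun h =>
  Tmax.pow_ne_zero' (abs_ne_zero h0) k (by rw [← map_pow, h, map_zero])

theorem mul_ne_zero_of_ne {x y : Smax Γ} (hx : x ≠ 0) (hy : y ≠ 0) : x * y ≠ 0 := fun h =>
  Tmax.mul_ne_zero' (abs_ne_zero hx) (abs_ne_zero hy) (by rw [← map_mul, h, map_zero])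

theorem e_mul_ne_zero {x : Smax Γ} (hx : x ≠ 0) : e * x ≠ 0 := fun h =>
  hx (by rw [← e_mul_e_mul x, h, mul_zero])

theorem coeff_X_add_C_mul_succ (a : Smax Γ) (Q : (Smax Γ)[X]) (k : ℕ) :
    ((X + C a) * Q).coeff (k + 1) = Q.coeff k + a * Q.coeff (k + 1) := by
  rw [add_mul, coeff_add, coeff_X_mul, coeff_C_mul]

theorem coeff_X_add_C_mul_zero (a : Smax Γ) (Q : (Smax Γ)[X]) :
    ((X + C a) * Q).coeff 0 = a * Q.coeff 0 := by
  simp [add_mul]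

/-- A nonzero root of multiplicity `m` forces `m` sign alternations among the dominant terms. -/
theorem MultGE.exists_alt {a : Smax Γ} (ha : IsSigned a) (ha0 : a ≠ 0) {m : ℕ} {P : (Smax Γ)[X]}
    (hP : ∀ i, IsSigned (P.coeff i)) (hP0 : P ≠ 0) (H : MultGE a m P) :
    ∃ x h, IsSigned x ∧ x ≠ 0 ∧ (∀ k, abs (P.coeff k * a ^ k) ≤ abs x) ∧
      Alt (fun k => P.coeff k * a ^ k) x (m + 1) h := by
  induction m generalizing P with
  | zero =>
    obtain ⟨k, hk, hmax⟩ := exists_dominant hP0 (abs a)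
    exact ⟨P.coeff k * a ^ k, k + 1, (hP k).mul (ha.pow k),
      mul_ne_zero_of_ne hk (pow_ne_zero_of_ne ha0 k),
      fun j => by simpa using hmax j, k, by omega, rfl, trivial⟩
  | succ m ih =>
    obtain ⟨hroot, rfl | ⟨Q, ⟨hQ, l, hl, hl0, hbal⟩, HQ⟩⟩ := H
    -- Last step of the recursion: only a root is known. Without the opposite of a dominant term,
    -- the value would be that signed nonzero term and could not balance 0.
    · obtain ⟨k, hk, hmax⟩ := exists_dominant hP0 (abs a)
      have hTs : ∀ j, IsSigned (P.coeff j * a ^ j) := fun j => (hP j).mul (ha.pow j)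
      have hk0 := mul_ne_zero_of_ne hk (pow_ne_zero_of_ne ha0 k)
      have hmax' : ∀ j, abs (P.coeff j * a ^ j) ≤ abs (P.coeff k * a ^ k) :=
        fun j => by simpa using hmax j
      have hj : ∃ j, P.coeff j * a ^ j = e * (P.coeff k * a ^ k) := by
        by_contra! hj
        refine (hTs k).not_balances_zero hk0 ?_
        rw [IsRoot, eval_eq_sum_range] at hroot
        rwa [sum_eq_of_mem (fun i _ => (hTs k).absorb (hTs i) (hj i) (hmax' i))
          (i := k) (Finset.mem_range_succ_iff.2 (le_natDegree_of_ne_zero hk)) rfl] at hroot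
      obtain ⟨j, hj⟩ := hj
      rcases lt_trichotomy j k with hjk | rfl | hjk
      · exact ⟨_, k + 1, hTs k, hk0, hmax', k, by omega, rfl, j, hjk, hj, trivial⟩
      · exact absurd hj ((hTs j).ne_e_mul hk0)
      · refine ⟨e * (P.coeff k * a ^ k), j + 1, isSigned_e.mul (hTs k), hj ▸ ?_, ?_, j, by omega,
          hj, k, hjk, (e_mul_e_mul _).symm, trivial⟩
        · intro h
          apply hk0
          rw [← e_mul_e_mul (P.coeff k * a ^ k), ← hj, h, mul_zero]
        · intro i; rw [abs_e_mul]; exact hmax' i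
    · have hQ0 : Q ≠ 0 := by
        rintro rfl
        apply hP0
        ext i
        have h := hbal i
        rw [mul_zero, coeff_zero, coeff_C_mul] at h
        have := h.eq (hl.mul (hP i)) isSigned_zero
        rw [coeff_zero]
        by_contra hi
        exact mul_ne_zero_of_ne hl0 hi this
      obtain ⟨x, h, hx, hx0, hmax, hA⟩ := ih hQ hQ0 HQ
      -- The bound is moved beyond the degree of Q, where the term vanishes and so differs from x,
      -- as `Alt.of_balances` requires.
      have hA := hA.mono (le_max_left h (Q.natDegree + 1))
      have hUs : ∀ j, IsSigned (Q.coeff j * a ^ j) := fun j => (hQ j).mul (ha.pow j)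
      have hTs : ∀ j, IsSigned (P.coeff j * a ^ j) := fun j => (hP j).mul (ha.pow j)
      -- Scaling the coefficient of index k by a^k turns the factor Y ⊖ a into a times a difference
      -- of consecutive terms.
      have hb0 : Balances (l * (P.coeff 0 * a ^ 0)) (a * (e * (Q.coeff 0 * a ^ 0))) := by
        have := hbal 0
        rw [coeff_C_mul, coeff_X_add_C_mul_zero, neg_eq] at this
        convert this using 1 <;> ring
      have hb : ∀ k, Balances (l * (P.coeff (k + 1) * a ^ (k + 1)))
          (a * (Q.coeff k * a ^ k + e * (Q.coeff (k + 1) * a ^ (k + 1)))) := by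
        intro k
        have := (hbal (k + 1)).mul_left (a ^ (k + 1))
        rw [coeff_C_mul, coeff_X_add_C_mul_succ, neg_eq] at this
        convert this using 1 <;> ring
      have hV := Alt.of_balances (V := fun k => l * (P.coeff k * a ^ k)) hUs
        (fun k => hl.mul (hTs k)) ha hx hx0 hmax hb0 hb hA (by
          rw [coeff_eq_zero_of_natDegree_lt (by omega), zero_mul]; exact hx0.symm)
      obtain ⟨l', hl', hll⟩ := exists_isSigned_mul_eq_one hl hl0
      have hxe : a * x = l * (l' * (a * x)) := by rw [← mul_assoc, hll, one_mul]
      have hax := mul_ne_zero_of_ne ha0 hx0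
      refine ⟨l' * (a * x), _, hl'.mul (ha.mul hx), fun h => hax (by rw [hxe, h, mul_zero]), ?_,
        Alt.cancel hl hl0 (hxe ▸ hV)⟩
      intro k
      apply Tmax.le_of_mul_le_mul_left' (abs_ne_zero hl0)
      rw [← map_mul, ← map_mul, ← hxe]
      rcases k with _ | k
      · refine (hb0.abs_le (hl.mul (hTs 0))).trans ?_
        rw [map_mul abs a (e * _), map_mul abs a x, abs_e_mul]
        exact Tmax.mul_le_mul_left' _ (hmax 0)
      · refine ((hb k).abs_le (hl.mul (hTs _))).trans ?_
        rw [map_mul, map_mul abs a x]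
        refine Tmax.mul_le_mul_left' _ (abs_add_le (hmax k) ?_)
        rw [abs_e_mul]; exact hmax _

/-- For a = 0 the division is by Y, so up to the factor λ a quotient is the shift of P, and each
step of the recursion kills one more low coefficient. -/
theorem MultGE.coeff_eq_zero {m : ℕ} {P : (Smax Γ)[X]} (hP : ∀ i, IsSigned (P.coeff i))
    (H : MultGE 0 m P) : ∀ k < m, P.coeff k = 0 := by
  induction m generalizing P with
  | zero => intro k hk; omega
  | succ m ih =>
    intro k hk
    obtain ⟨hroot, hQ⟩ := H
    rcases k with _ | k
    · rw [IsRoot, ← coeff_zero_eq_eval_zero] at hroot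
      exact hroot.eq (hP 0) isSigned_zero
    · rcases hQ with rfl | ⟨Q, ⟨hQ, l, hl, hl0, hbal⟩, HQ⟩
      · omega
      · have h := hbal (k + 1)
        rw [coeff_C_mul, coeff_X_add_C_mul_succ, neg_eq, mul_zero, zero_mul, add_zero,
          ih hQ HQ k (by omega)] at h
        by_contra hk
        exact mul_ne_zero_of_ne hl0 hk (h.eq (hl.mul (hP _)) isSigned_zero)

/-- A finite supremum of natural numbers is attained. -/
theorem multGE_of_mult_eq {a : Smax Γ} {P : (Smax Γ)[X]} {m : ℕ} (h : mult a P = m) :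
    MultGE a m P := by
  rcases m with _ | m
  · trivial
  by_contra hm
  have hle : mult a P ≤ m := by
    refine iSup₂_le fun k hk => ?_
    have h1 : (k : ℕ∞) ≤ ((m + 1 : ℕ) : ℕ∞) := h ▸ le_iSup₂_of_le k hk le_rfl
    have h1 : k ≤ m + 1 := by exact_mod_cast h1
    have h2 : k ≠ m + 1 := by rintro rfl; exact hm hk
    exact_mod_cast (by omega : k ≤ m)
  rw [h] at hle
  have : m + 1 ≤ m := by exact_mod_cast hle
  omega

end Smax

/-! ### A counting lemma -/

/-- If disjoint consecutive intervals `[lo c, hi c)` of `[0, n)` can host the fibres of `A`, they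
are filled up by them. -/
theorem card_filter_eq_of_intervals {α : Type*} [LinearOrder α] {n : ℕ} (A : Fin n → α)
    (lo hi : α → ℕ) (hn : ∀ c, hi c ≤ n) (hlt : ∀ c c', c < c' → hi c ≤ lo c')
    (hcard : ∀ c, (Finset.univ.filter fun i => A i = c).card + lo c ≤ hi c) (c : α) :
    lo c = (Finset.univ.filter fun i => A i < c).card ∧
      hi c = (Finset.univ.filter fun i => A i ≤ c).card ∧
      (Finset.univ.filter fun i => A i = c).card + lo c = hi c := by
  classical
  have hsum : ∀ (p : α → Prop) [DecidablePred p] (u v : ℕ), (∀ b, p b → u ≤ lo b ∧ hi b ≤ v) →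
      (Finset.univ.filter fun i => p (A i)).card ≤ v - u := by
    intro p _ u v huv
    rw [Finset.card_eq_sum_card_image A, ← Nat.card_Ico]
    calc _ ≤ ∑ b ∈ (Finset.univ.filter fun i => p (A i)).image A,
          (Finset.Ico (lo b) (hi b)).card := by
          refine Finset.sum_le_sum fun b _ => ?_
          rw [Nat.card_Ico]
          have h1 := hcard b
          have h2 := Finset.card_le_card (s := (Finset.univ.filter fun i => p (A i)).filter
            fun i => A i = b) (t := Finset.univ.filter fun i => A i = b)
            (Finset.filter_subset_filter _ (Finset.subset_univ _))
          omega
      _ = (((Finset.univ.filter fun i => p (A i)).image A).biUnion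
          fun b => Finset.Ico (lo b) (hi b)).card := by
          rw [Finset.card_biUnion]
          intro b _ b' _ hb
          rw [Function.onFun, Finset.disjoint_left]
          intro k hk hk'
          rw [Finset.mem_Ico] at hk hk'
          rcases lt_or_gt_of_ne hb with h | h
          · have := hlt _ _ h; omega
          · have := hlt _ _ h; omega
      _ ≤ _ := by
          refine Finset.card_le_card fun k hk => ?_
          simp only [Finset.mem_biUnion, Finset.mem_image, Finset.mem_filter, Finset.mem_univ,
            true_and, Finset.mem_Ico] at hk ⊢
          obtain ⟨b, ⟨i, hi', rfl⟩, hk⟩ := hk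
          have := huv _ hi'
          omega
  -- The fibres below, above and at c have at most lo c, n − hi c and hi c − lo c elements. These
  -- bounds add up to n, so all three are attained.
  have h1 := hsum (fun b => b < c) 0 (lo c) fun b hb => ⟨Nat.zero_le _, hlt _ _ hb⟩
  have h2 := hsum (fun b => c < b) (hi c) n fun b hb => ⟨hlt _ _ hb, hn b⟩
  have h3 := hcard c
  have h4 := hn c
  have h5 : (Finset.univ.filter fun i => A i ≤ c).card =
      (Finset.univ.filter fun i => A i < c).card + (Finset.univ.filter fun i => A i = c).card := by
    rw [← Finset.card_union_of_disjoint]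
    · congr 1; ext i; simp [le_iff_lt_or_eq]
    · rw [Finset.disjoint_filter]; intro i _ h; exact h.ne
  have h6 : n = (Finset.univ.filter fun i => A i ≤ c).card +
      (Finset.univ.filter fun i => c < A i).card := by
    have := Finset.card_filter_add_card_filter_not (s := (Finset.univ : Finset (Fin n)))
      (fun i => A i ≤ c)
    simp only [not_le, Finset.card_univ, Fintype.card_fin] at this
    exact this.symm
  omega

/-! ### Edges of the Newton polygon -/

namespace Smax

variable {Γ : Type*} [AddCommGroup Γ] [LinearOrder Γ] [IsOrderedAddMonoid Γ]

open Polynomial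

/-- The monomial of index `k` is nonzero and dominates the polynomial `P` at absolute value `c`. -/
def IsDominant (P : (Smax Γ)[X]) (c : Tmax Γ) (k : ℕ) : Prop :=
  P.coeff k ≠ 0 ∧ ∀ j, abs (P.coeff j) * c ^ j ≤ abs (P.coeff k) * c ^ k

/-- `lo` and `hi` are the extreme indices of the dominant monomials of `P` at `c`. -/
structure IsEdge (P : (Smax Γ)[X]) (c : Tmax Γ) (lo hi : ℕ) : Prop where
  left : IsDominant P c lo
  right : IsDominant P c hi
  mem : ∀ k, IsDominant P c k → lo ≤ k ∧ k ≤ hi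

theorem exists_isEdge {P : (Smax Γ)[X]} (h0 : P ≠ 0) (c : Tmax Γ) : ∃ lo hi, IsEdge P c lo hi := by
  classical
  let D := P.support.filter (IsDominant P c)
  have hD : ∀ k, k ∈ D ↔ IsDominant P c k := fun k => by
    simp only [D, Finset.mem_filter, mem_support_iff, and_iff_right_iff_imp]
    exact fun h => h.1
  have hne : D.Nonempty := by
    obtain ⟨k, hk⟩ := exists_dominant h0 c
    exact ⟨k, (hD k).2 hk⟩
  exact ⟨D.min' hne, D.max' hne, (hD _).1 (D.min'_mem hne), (hD _).1 (D.max'_mem hne),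
    fun k hk => ⟨D.min'_le _ ((hD k).2 hk), D.le_max' _ ((hD k).2 hk)⟩⟩

/-- Raising the modulus favours higher degrees strictly: if k' < k, the monomial k, already at least
as large as k' at c, would beat it strictly at c'. -/
theorem IsDominant.le_of_lt {P : (Smax Γ)[X]} {c c' : Tmax Γ} {k k' : ℕ} (hc : c ≠ 0)
    (h : IsDominant P c k) (h' : IsDominant P c' k') (hcc : c < c') : k ≤ k' := by
  by_contra! hk
  obtain ⟨d, rfl⟩ := Nat.exists_eq_add_of_lt hk
  have hc' : c' ≠ 0 := Tmax.pos_iff.1 ((Tmax.zero_le' c).trans_lt hcc)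
  have h1 : abs (P.coeff k') ≤ abs (P.coeff (k' + d + 1)) * c ^ (d + 1) := by
    apply Tmax.le_of_mul_le_mul_left' (Tmax.pow_ne_zero' hc k')
    convert h.2 k' using 1 <;> ring
  have h2 : abs (P.coeff (k' + d + 1)) * c' ^ (d + 1) ≤ abs (P.coeff k') := by
    apply Tmax.le_of_mul_le_mul_left' (Tmax.pow_ne_zero' hc' k')
    convert h'.2 (k' + d + 1) using 1 <;> ring
  exact (h2.trans h1).not_gt
    (Tmax.mul_lt_mul_left' (abs_ne_zero h.1) (Tmax.pow_lt_pow' hcc d.succ_ne_zero))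

theorem e_pow_mul_eq_or (k : ℕ) (x : Smax Γ) : e ^ k * x = x ∨ e ^ k * x = e * x := by
  induction k with
  | zero => simp
  | succ k ih =>
    rw [pow_succ', mul_assoc]
    rcases ih with ih | ih <;> rw [ih]
    · exact Or.inr rfl
    · left; exact e_mul_e_mul x

/-- The multiplicities of `a` and `⊖ a` are bounded by the length of the edge at `|a|`; in the case
of equality the signs of the dominant monomials alternate exactly `mult a` times at `a`. -/
theorem IsEdge.add_le {P : (Smax Γ)[X]} (hP : ∀ i, IsSigned (P.coeff i)) {a : Smax Γ}
    (ha : IsSigned a) (ha0 : a ≠ 0) {lo hi : ℕ} (hE : IsEdge P (abs a) lo hi) {s t : ℕ}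
    (Hs : MultGE a s P) (Ht : MultGE (e * a) t P) :
    s + t + lo ≤ hi ∧ (s + t + lo = hi →
      P.coeff lo * a ^ lo = e ^ s * (P.coeff hi * a ^ hi) ∧
      (s = 0 → ∀ k, IsDominant P (abs a) k → P.coeff k * a ^ k = P.coeff hi * a ^ hi) ∧
      (s ≠ 0 → ∃ k, P.coeff k ≠ 0 ∧ P.coeff k * a ^ k = e * (P.coeff hi * a ^ hi))) := by
  have hP0 : P ≠ 0 := by rintro rfl; exact hE.left.1 (coeff_zero _)
  set T : ℕ → Smax Γ := fun k => P.coeff k * a ^ k with hT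
  have hTs : ∀ k, IsSigned (T k) := fun k => (hP k).mul (ha.pow k)
  set w := T hi with hw
  have hw0 : w ≠ 0 := mul_ne_zero_of_ne hE.right.1 (pow_ne_zero_of_ne ha0 hi)
  have hmax : ∀ k, abs (T k) ≤ abs w := fun k => by
    simpa [hw, hT] using hE.right.2 k
  have hdom : ∀ k, abs (T k) = abs w → IsDominant P (abs a) k := fun k hk => by
    refine ⟨fun h => ?_, fun j => ?_⟩
    · simp only [hT, h, zero_mul, map_zero] at hk
      exact abs_ne_zero hw0 hk.symm
    · have := hk ▸ hmax j
      simpa [hT] using this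
  have hdom' : ∀ k, IsDominant P (abs a) k → T k = w ∨ T k = e * w := fun k hk => by
    refine (hTs k).eq_or_eq_of_abs_eq (hTs hi) (le_antisymm (hmax k) ?_)
    simpa [hw, hT] using hk.2 hi
  have hdom'' : ∀ k, T k = w ∨ T k = e * w → IsDominant P (abs a) k := fun k hk =>
    hdom k (by rcases hk with h | h <;> rw [h]; rw [abs_e_mul])
  have hlo : ∀ k, T k = w ∨ T k = e * w → lo ≤ k := fun k hk => (hE.mem k (hdom'' k hk)).1
  have hlohi : lo ≤ hi := (hE.mem hi hE.right).1
  obtain ⟨x, h, hx, hx0, hxmax, hA⟩ := Hs.exists_alt ha ha0 hP hP0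
  obtain ⟨z, h', hz, hz0, hzmax, hB⟩ := Ht.exists_alt (isSigned_e.mul ha)
    (e_mul_ne_zero ha0) hP hP0
  -- The terms at ⊖a are the twisted terms at a, so both chains fall under `Alt.add_le`.
  have hTe : (fun k => P.coeff k * (e * a) ^ k) = fun k => e ^ k * T k := by
    funext k; simp only [hT, mul_pow]; ring
  have habs : ∀ k, abs (P.coeff k * (e * a) ^ k) = abs (T k) := fun k => by simp [hT, abs_e]
  have hA' : (x = w ∨ x = e * w) ∧ Alt T x (s + 1) (hi + 1) := by
    obtain ⟨k, -, hk, hA⟩ := hA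
    have hxw : abs x = abs w := le_antisymm (hk ▸ hmax k) (hxmax hi)
    refine ⟨hx.eq_or_eq_of_abs_eq (hTs hi) hxw, k, Nat.lt_succ_of_le ?_, hk, hA⟩
    exact (hE.mem k (hdom k (by rw [← hxw, ← hk]))).2
  have hB' : (z = w ∨ z = e * w) ∧ Alt (fun k => e ^ k * T k) z (t + 1) (hi + 1) := by
    rw [hTe] at hB
    obtain ⟨k, -, hk, hB⟩ := hB
    have hk' : abs (T k) = abs z := by simp [← hk, abs_e]
    have hzw : abs z = abs w :=
      le_antisymm (hk' ▸ hmax k) (by have := hzmax hi; rwa [habs] at this)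
    refine ⟨hz.eq_or_eq_of_abs_eq (hTs hi) hzw, k, Nat.lt_succ_of_le ?_, hk, hB⟩
    exact (hE.mem k (hdom k (hk'.trans hzw))).2
  -- With u = s + 1 this is the inequality. In the case of equality it forbids any chain of s + 2
  -- terms, from which the sign statements follow.
  have hbound : ∀ y u, (y = w ∨ y = e * w) → Alt T y u (hi + 1) → u + (t + 1) + lo ≤ hi + 2 :=
    fun y u hy H => (Alt.add_le (hTs hi) hw0 hlo hlohi hy hB'.1 H hB'.2).1
  refine ⟨by have := hbound x _ hA'.1 hA'.2; omega, fun heq => ?_⟩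
  obtain ⟨hxw, hA⟩ := hA'
  have hne := (hTs hi).ne_e_mul hw0
  -- A chain starting with ⊖w could be prolonged upwards by the index hi.
  have hxw : x = w := by
    refine hxw.resolve_right fun hxw => ?_
    have := hbound w (s + 2) (Or.inl rfl) ⟨hi, by omega, rfl, hxw ▸ hA.of_succ (hxw ▸ hne)⟩
    omega
  subst hxw
  refine ⟨?_, ?_, ?_⟩
  · have h1 := hdom' lo hE.left
    have h2 : T lo ≠ e ^ (s + 1) * w := fun h2 => by
      have := hbound w (s + 2) (Or.inl rfl) (hA.extend_below (hTs hi) hw0 hlo h2)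
      omega
    rw [pow_succ', mul_assoc] at h2
    change T lo = e ^ s * w
    rcases e_pow_mul_eq_or s w with h3 | h3 <;> rw [h3] at h2 ⊢
    · exact h1.resolve_right h2
    · rw [e_mul_e_mul] at h2; exact h1.resolve_left h2
  · rintro rfl k hk
    refine (hdom' k hk).resolve_right fun h1 => ?_
    have hk' : k < hi := lt_of_le_of_ne (hE.mem k hk).2 (by rintro rfl; exact hne h1)
    have := hbound w 2 (Or.inl rfl) ⟨hi, by omega, rfl, k, hk', h1, trivial⟩
    omega
  · intro hs
    obtain ⟨s, rfl⟩ := Nat.exists_eq_succ_of_ne_zero hs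
    obtain ⟨-, -, -, k, -, hk, -⟩ := hA
    exact ⟨k, (hdom'' k (Or.inr hk)).1, hk⟩

theorem exists_isSigned_abs_eq (c : Tmax Γ) : ∃ a : Smax Γ, IsSigned a ∧ abs a = c :=
  ⟨mk c 0, ⟨c, Or.inl rfl⟩, by rw [abs_mk, add_zero]⟩

theorem one_add_e_pow {k : ℕ} (hk : k ≠ 0) : (1 + e : Smax Γ) ^ k = 1 + e := by
  obtain ⟨k, rfl⟩ := Nat.exists_eq_succ_of_ne_zero hk
  induction k with
  | zero => simp
  | succ k ih => rw [Nat.succ_eq_add_one, pow_succ, ih k.succ_ne_zero, one_add_e_sq]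

/-! ### Root counts, edge lengths and vertex coefficients -/

open Classical in
/-- The number of occurrences of `a` in the family `r`. -/
noncomputable def count {n : ℕ} (r : Fin n → Smax Γ) (a : Smax Γ) : ℕ :=
  (Finset.univ.filter fun i => r i = a).card

open Classical in
theorem filter_abs_eq {n : ℕ} {r : Fin n → Smax Γ} (hr : ∀ i, IsSigned (r i)) {a : Smax Γ}
    (ha : IsSigned a) :
    (Finset.univ.filter fun i => abs (r i) = abs a) =
      (Finset.univ.filter fun i => r i = a) ∪ (Finset.univ.filter fun i => r i = e * a) := by
  ext i
  simp only [Finset.mem_filter, Finset.mem_univ, true_and, Finset.mem_union]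
  refine ⟨fun h => (hr i).eq_or_eq_of_abs_eq ha h, ?_⟩
  rintro (h | h) <;> rw [h]
  rw [abs_e_mul]

/-- A product over the members of absolute value `|a|` of a signed family. -/
theorem prod_abs_eq {n : ℕ} {r : Fin n → Smax Γ} (hr : ∀ i, IsSigned (r i)) {a : Smax Γ}
    (ha : IsSigned a) (ha0 : a ≠ 0) (f : Smax Γ → Smax Γ) :
    ∏ i with abs (r i) = abs a, f (r i) = f a ^ count r a * f (e * a) ^ count r (e * a) := by
  classical
  rw [filter_abs_eq hr ha, Finset.prod_union]
  · congr 1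
    · rw [count, ← Finset.prod_const]
      exact Finset.prod_congr (by congr) fun i hi => by rw [(Finset.mem_filter.1 hi).2]
    · rw [count, ← Finset.prod_const]
      exact Finset.prod_congr (by congr) fun i hi => by rw [(Finset.mem_filter.1 hi).2]
  · rw [Finset.disjoint_filter]
    intro i _ h h'
    exact ha.ne_e_mul ha0 (h.symm.trans h')

theorem card_abs_eq {n : ℕ} {r : Fin n → Smax Γ} (hr : ∀ i, IsSigned (r i)) {a : Smax Γ}
    (ha : IsSigned a) (ha0 : a ≠ 0) :
    (Finset.univ.filter fun i => abs (r i) = abs a).card = count r a + count r (e * a) := by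
  classical
  rw [filter_abs_eq hr ha, Finset.card_union_of_disjoint]
  · rw [count, count]
  · rw [Finset.disjoint_filter]
    intro i _ h h'
    exact ha.ne_e_mul ha0 (h.symm.trans h')

/-- Under the hypothesis on the number of roots, each edge of `P` is exactly as long as the number
of roots of the corresponding absolute value. -/
theorem IsEdge.card_eq {n : ℕ} {P : (Smax Γ)[X]} (hP : ∀ i, IsSigned (P.coeff i))
    (hdeg : P.degree = n) {r : Fin n → Smax Γ} (hr : ∀ i, IsSigned (r i))
    (hmult : ∀ a, IsSigned a → MultGE a (count r a) P) {c : Tmax Γ} (hc : c ≠ 0) {lo hi : ℕ}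
    (hE : IsEdge P c lo hi) :
    lo = (Finset.univ.filter fun i => abs (r i) < c).card ∧
      hi = (Finset.univ.filter fun i => abs (r i) ≤ c).card ∧
      (Finset.univ.filter fun i => abs (r i) = c).card + lo = hi := by
  have hP0 : P ≠ 0 := by rintro rfl; simp at hdeg
  -- The root 0 occupies the interval from 0 to the trailing degree, which completes the family of
  -- edges at c = ⊥.
  have hex : ∀ c : Tmax Γ, ∃ p : ℕ × ℕ, (c ≠ 0 → IsEdge P c p.1 p.2) ∧
      (c = 0 → p = (0, P.natTrailingDegree)) := by
    intro c
    by_cases hc : c = 0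
    · exact ⟨_, fun h => absurd hc h, fun _ => rfl⟩
    · obtain ⟨lo, hi, h⟩ := exists_isEdge hP0 c
      exact ⟨(lo, hi), fun _ => h, fun h => absurd h hc⟩
  choose p hp hp0 using hex
  have hn : P.natDegree = n := natDegree_eq_of_degree_eq_some hdeg
  have key := card_filter_eq_of_intervals (fun i => abs (r i)) (fun c => (p c).1)
    (fun c => (p c).2) (fun c => ?_) (fun c c' h => ?_) (fun c => ?_) c
  · have h1 : (p c).1 = lo :=
      le_antisymm ((hp c hc).mem _ hE.left).1 (hE.mem _ (hp c hc).left).1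
    have h2 : (p c).2 = hi :=
      le_antisymm (hE.mem _ (hp c hc).right).2 ((hp c hc).mem _ hE.right).2
    simpa only [h1, h2] using key
  · by_cases hc : c = 0
    · rw [hp0 c hc, ← hn]; exact natTrailingDegree_le_natDegree P
    · rw [← hn]; exact le_natDegree_of_ne_zero (hp c hc).right.1
  · have hc' : c' ≠ 0 := Tmax.pos_iff.1 ((Tmax.zero_le' c).trans_lt h)
    by_cases hc : c = 0
    · simp only [hp0 c hc]; exact natTrailingDegree_le_of_ne_zero (hp c' hc').left.1
    · exact (hp c hc).right.le_of_lt hc (hp c' hc').left h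
  · by_cases hc : c = 0
    · subst hc
      simp only [hp0 0 rfl, abs_eq_zero, add_zero]
      refine le_natTrailingDegree hP0 fun k hk => ?_
      refine (hmult 0 isSigned_zero).coeff_eq_zero hP k ?_
      rw [count]; convert hk; exact abs_eq_zero.symm
    · obtain ⟨a, ha, rfl⟩ := exists_isSigned_abs_eq c
      have ha0 : a ≠ 0 := fun h => hc (by rw [h, map_zero])
      rw [card_abs_eq hr ha ha0]
      exact ((hp _ hc).add_le hP ha ha0 (hmult a ha) (hmult _ (isSigned_e.mul ha))).1

/-- The coefficients at the two ends of an edge. -/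
theorem IsEdge.coeff_left {n : ℕ} {P : (Smax Γ)[X]} (hP : ∀ i, IsSigned (P.coeff i))
    (hdeg : P.degree = n) {r : Fin n → Smax Γ} (hr : ∀ i, IsSigned (r i))
    (hmult : ∀ a, IsSigned a → MultGE a (count r a) P) {c : Tmax Γ} (hc : c ≠ 0) {lo hi : ℕ}
    (hE : IsEdge P c lo hi) :
    P.coeff lo = P.coeff hi * ∏ i with abs (r i) = c, e * r i := by
  obtain ⟨-, -, h3⟩ := hE.card_eq hP hdeg hr hmult hc
  obtain ⟨a, ha, rfl⟩ := exists_isSigned_abs_eq c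
  have ha0 : a ≠ 0 := fun h => hc (by rw [h, map_zero])
  rw [card_abs_eq hr ha ha0] at h3
  have h4 := ((hE.add_le hP ha ha0 (hmult a ha) (hmult _ (isSigned_e.mul ha))).2 h3).1
  apply (ha.pow lo).mul_left_cancel (pow_ne_zero_of_ne ha0 lo)
  -- With s roots a and t roots ⊖a, the product of the ⊖r_i is (⊖a)^s a^t = (⊖1)^s a^(s+t), and hi =
  -- s + t + lo.
  rw [mul_comm, h4, prod_abs_eq hr ha ha0 (fun x => e * x), ← h3, e_mul_e_mul]
  ring

/-- Telescoping along the polygon: the edge at the next larger root modulus starts where this one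
ends, and beyond the last root modulus the vertex is n. -/
theorem IsEdge.coeff_right {n : ℕ} {P : (Smax Γ)[X]} (hP : ∀ i, IsSigned (P.coeff i))
    (hdeg : P.degree = n) {r : Fin n → Smax Γ} (hr : ∀ i, IsSigned (r i))
    (hmult : ∀ a, IsSigned a → MultGE a (count r a) P) {c : Tmax Γ} (hc : c ≠ 0) {lo hi : ℕ}
    (hE : IsEdge P c lo hi) :
    P.coeff hi = P.coeff n * ∏ i with c < abs (r i), e * r i := by
  classical
  have hP0 : P ≠ 0 := by rintro rfl; simp at hdeg
  induction hk : (Finset.univ.filter fun i => c < abs (r i)).card using Nat.strong_induction_on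
    generalizing c lo hi with
  | _ k ih =>
    obtain ⟨-, h2, -⟩ := hE.card_eq hP hdeg hr hmult hc
    rcases (Finset.univ.filter fun i => c < abs (r i)).eq_empty_or_nonempty with h0 | h0
    · rw [h0, Finset.prod_empty, mul_one, h2, Finset.filter_true_of_mem, Finset.card_univ,
        Fintype.card_fin]
      intro i _
      exact not_lt.1 (Finset.filter_eq_empty_iff.1 h0 (Finset.mem_univ i))
    · obtain ⟨i₀, hi₀, hmin⟩ := Finset.exists_min_image _ (fun i => abs (r i)) h0
      have hi₀ := (Finset.mem_filter.1 hi₀).2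
      have hmin : ∀ i, c < abs (r i) → abs (r i₀) ≤ abs (r i) := fun i hi =>
        hmin i (Finset.mem_filter.2 ⟨Finset.mem_univ i, hi⟩)
      obtain ⟨lo', hi', hE'⟩ := exists_isEdge hP0 (abs (r i₀))
      have hc' : abs (r i₀) ≠ 0 := Tmax.pos_iff.1 ((Tmax.zero_le' c).trans_lt hi₀)
      obtain ⟨h1', -, -⟩ := hE'.card_eq hP hdeg hr hmult hc'
      have hlo : lo' = hi := by
        rw [h1', h2]
        congr 1
        ext i
        simp only [Finset.mem_filter, Finset.mem_univ, true_and]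
        exact ⟨fun h => not_lt.1 fun h' => (hmin i h').not_gt h, fun h => h.trans_lt hi₀⟩
      have hsplit : (Finset.univ.filter fun i => c < abs (r i)) =
          (Finset.univ.filter fun i => abs (r i₀) < abs (r i)) ∪
            (Finset.univ.filter fun i => abs (r i) = abs (r i₀)) := by
        ext i
        simp only [Finset.mem_filter, Finset.mem_univ, true_and, Finset.mem_union]
        refine ⟨fun h => (hmin i h).lt_or_eq.imp id Eq.symm, ?_⟩
        rintro (h | h)
        · exact hi₀.trans h
        · rwa [h]
      have hdisj : Disjoint (Finset.univ.filter fun i => abs (r i₀) < abs (r i))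
          (Finset.univ.filter fun i => abs (r i) = abs (r i₀)) := by
        rw [Finset.disjoint_filter]; intro i _ h; exact h.ne'
      have hlt : (Finset.univ.filter fun i => abs (r i₀) < abs (r i)).card < k := by
        rw [← hk, hsplit, Finset.card_union_of_disjoint hdisj]
        have : 0 < (Finset.univ.filter fun i => abs (r i) = abs (r i₀)).card :=
          Finset.card_pos.2 ⟨i₀, Finset.mem_filter.2 ⟨Finset.mem_univ _, rfl⟩⟩
        omega
      rw [hsplit, Finset.prod_union hdisj, ← mul_assoc, ← ih _ hlt hc' hE' rfl, ← hlo]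
      exact hE'.coeff_left hP hdeg hr hmult hc'

theorem prod_split {n : ℕ} (A : Fin n → Tmax Γ) (c : Tmax Γ) (f : Fin n → Smax Γ) :
    ∏ i, f i = (∏ i with c < A i, f i) * (∏ i with A i = c, f i) * ∏ i with A i < c, f i := by
  classical
  rw [← Finset.prod_filter_mul_prod_filter_not Finset.univ (fun i => c < A i), mul_assoc]
  congr 1
  rw [← Finset.prod_filter_mul_prod_filter_not
    (Finset.univ.filter fun i => ¬ c < A i) (fun i => A i = c)]
  congr 1
  · refine Finset.prod_congr ?_ fun _ _ => rfl
    ext i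
    simp only [Finset.mem_filter, Finset.mem_univ, true_and]
    exact ⟨fun h => h.2, fun h => ⟨h.not_gt, h⟩⟩
  · refine Finset.prod_congr ?_ fun _ _ => rfl
    ext i
    simp only [Finset.mem_filter, Finset.mem_univ, true_and]
    exact ⟨fun h => lt_of_le_of_ne (not_lt.1 h.1) h.2, fun h => ⟨h.not_gt, h.ne⟩⟩

/-- This is the theorem at y = 0. If 0 is not a root, the edge at the smallest root modulus starts
at index 0. -/
theorem coeff_zero_eq {n : ℕ} {P : (Smax Γ)[X]} (hP : ∀ i, IsSigned (P.coeff i))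
    (hdeg : P.degree = n) {r : Fin n → Smax Γ} (hr : ∀ i, IsSigned (r i))
    (hmult : ∀ a, IsSigned a → MultGE a (count r a) P) :
    P.coeff 0 = P.coeff n * ∏ i, e * r i := by
  classical
  have hP0 : P ≠ 0 := by rintro rfl; simp at hdeg
  by_cases h0 : ∃ i, r i = 0
  · obtain ⟨i, hi⟩ := h0
    rw [Finset.prod_eq_zero (Finset.mem_univ i) (by rw [hi, mul_zero]), mul_zero]
    refine (hmult 0 isSigned_zero).coeff_eq_zero hP 0 ?_
    exact Finset.card_pos.2 ⟨i, Finset.mem_filter.2 ⟨Finset.mem_univ _, hi⟩⟩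
  push Not at h0
  rcases Nat.eq_zero_or_pos n with rfl | hn
  · simp
  obtain ⟨i₀, -, hmin⟩ := Finset.exists_min_image Finset.univ (fun i => abs (r i))
    ⟨⟨0, hn⟩, Finset.mem_univ _⟩
  have hc := abs_ne_zero (h0 i₀)
  obtain ⟨lo, hi, hE⟩ := exists_isEdge hP0 (abs (r i₀))
  have hempty : (Finset.univ.filter fun i => abs (r i) < abs (r i₀)) = ∅ :=
    Finset.filter_eq_empty_iff.2 fun i hi => not_lt.2 (hmin i hi)
  have hlo : lo = 0 := by
    rw [(hE.card_eq hP hdeg hr hmult hc).1, hempty, Finset.card_empty]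
  rw [prod_split (fun i => abs (r i)) (abs (r i₀)), hempty, Finset.prod_empty, mul_one, ← mul_assoc,
    ← hE.coeff_right hP hdeg hr hmult hc, ← hE.coeff_left hP hdeg hr hmult hc, hlo]

/-- The product `P_n ⊙ ∏ (y ⊖ r_i)` at a nonzero point `y`. -/
theorem IsEdge.prod_eq {n : ℕ} {P : (Smax Γ)[X]} (hP : ∀ i, IsSigned (P.coeff i))
    (hdeg : P.degree = n) {r : Fin n → Smax Γ} (hr : ∀ i, IsSigned (r i))
    (hmult : ∀ a, IsSigned a → MultGE a (count r a) P) {y : Smax Γ} (hy : y ≠ 0) {lo hi : ℕ}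
    (hE : IsEdge P (abs y) lo hi) :
    P.coeff n * ∏ i, (y + e * r i) =
      P.coeff hi * (∏ i with abs (r i) = abs y, (y + e * r i)) * y ^ lo := by
  have hc := abs_ne_zero hy
  rw [prod_split (fun i => abs (r i)) (abs y), ← mul_assoc, ← mul_assoc]
  congr 1
  · congr 1
    rw [hE.coeff_right hP hdeg hr hmult hc]
    congr 1
    refine Finset.prod_congr rfl fun i hi => ?_
    exact add_eq_right_of_abs_lt (by rw [abs_e_mul]; exact (Finset.mem_filter.1 hi).2)
  · rw [(hE.card_eq hP hdeg hr hmult hc).1, ← Finset.prod_const]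
    refine Finset.prod_congr rfl fun i hi => ?_
    rw [add_comm]
    exact add_eq_right_of_abs_lt (by rw [abs_e_mul]; exact (Finset.mem_filter.1 hi).2)

/-! ### Comparison of the polynomial function with the product -/

theorem IsDominant.abs_term_le {P : (Smax Γ)[X]} {y : Smax Γ} {k : ℕ}
    (h : IsDominant P (abs y) k) (j : ℕ) :
    abs (P.coeff j * y ^ j) ≤ abs (P.coeff k * y ^ k) := by
  simpa using h.2 j

theorem IsDominant.mem_range {P : (Smax Γ)[X]} {c : Tmax Γ} {k : ℕ} (h : IsDominant P c k) :
    k ∈ Finset.range (P.natDegree + 1) :=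
  Finset.mem_range_succ_iff.2 (le_natDegree_of_ne_zero h.1)

theorem eval_signed_eq {n : ℕ} {P : (Smax Γ)[X]} (hP : ∀ i, IsSigned (P.coeff i))
    (hdeg : P.degree = n) {r : Fin n → Smax Γ} (hr : ∀ i, IsSigned (r i))
    (hmult : ∀ a, IsSigned a → MultGE a (count r a) P) {y : Smax Γ} (hy : IsSigned y)
    (hy0 : y ≠ 0) : P.eval y = P.coeff n * ∏ i, (y + e * r i) := by
  have hP0 : P ≠ 0 := by rintro rfl; simp at hdeg
  obtain ⟨lo, hi, hE⟩ := exists_isEdge hP0 (abs y)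
  obtain ⟨-, -, h3⟩ := hE.card_eq hP hdeg hr hmult (abs_ne_zero hy0)
  rw [card_abs_eq hr hy hy0] at h3
  obtain ⟨-, hs0, hs⟩ :=
    (hE.add_le hP hy hy0 (hmult y hy) (hmult _ (isSigned_e.mul hy))).2 h3
  have hTs : ∀ j, IsSigned (P.coeff j * y ^ j) := fun j => (hP j).mul (hy.pow j)
  rw [hE.prod_eq hP hdeg hr hmult hy0, prod_abs_eq hr hy hy0 (fun x => y + e * x), e_mul_e_mul,
    add_self, eval_eq_sum_range]
  have hyy : y + e * y = y * (1 + e) := by ring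
  rw [hyy]
  -- If y is not a root, all dominant terms coincide and the sum is signed. Otherwise dominant terms
  -- of both signs occur, matching the power of y ⊖ y in the product.
  by_cases h : count r y = 0
  · rw [h] at h3 ⊢
    rw [sum_eq_of_mem (z := P.coeff hi * y ^ hi) (fun j _ => ?_) hE.right.mem_range rfl, ← h3]
    · ring
    · refine (hTs hi).absorb (hTs j) (fun hj => ?_) (hE.right.abs_term_le j)
      have hw0 : P.coeff hi * y ^ hi ≠ 0 :=
        mul_ne_zero_of_ne hE.right.1 (pow_ne_zero_of_ne hy0 hi)
      have hjd : IsDominant P (abs y) j := by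
        refine ⟨fun h => e_mul_ne_zero hw0 (by rw [← hj, h, zero_mul]), fun i => ?_⟩
        have := hE.right.abs_term_le i
        rw [← abs_e_mul (P.coeff hi * y ^ hi), ← hj] at this
        simpa using this
      exact (hTs hi).ne_e_mul hw0 ((hs0 h j hjd).symm.trans hj)
  · obtain ⟨k, hk, hke⟩ := hs h
    rw [sum_eq_balanced (hTs hi) (fun j _ => hE.right.abs_term_le j) hE.right.mem_range
      (Finset.mem_range_succ_iff.2 (le_natDegree_of_ne_zero hk)) rfl hke, mul_pow,
      one_add_e_pow h, ← h3]
    ring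

theorem eval_balanced_eq {n : ℕ} {P : (Smax Γ)[X]} (hP : ∀ i, IsSigned (P.coeff i))
    (hdeg : P.degree = n) {r : Fin n → Smax Γ} (hr : ∀ i, IsSigned (r i))
    (hmult : ∀ a, IsSigned a → MultGE a (count r a) P) {x : Smax Γ} (hx : IsSigned x)
    (hx0 : x ≠ 0) :
    P.eval (x * (1 + e)) = P.coeff n * ∏ i, (x * (1 + e) + e * r i) := by
  have hP0 : P ≠ 0 := by rintro rfl; simp at hdeg
  have habs : abs (x * (1 + e)) = abs x := by rw [map_mul, abs_one_add_e, mul_one]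
  have hy0 : x * (1 + e) ≠ 0 := fun h => abs_ne_zero hx0 (by rw [← habs, h, map_zero])
  obtain ⟨lo, hi, hE⟩ := exists_isEdge hP0 (abs (x * (1 + e)))
  obtain ⟨-, -, h3⟩ := hE.card_eq hP hdeg hr hmult (abs_ne_zero hy0)
  have hprod : ∏ i with abs (r i) = abs (x * (1 + e)), (x * (1 + e) + e * r i) =
      (x * (1 + e)) ^ (Finset.univ.filter fun i => abs (r i) = abs (x * (1 + e))).card := by
    rw [← Finset.prod_const]
    refine Finset.prod_congr rfl fun i hi => ?_
    rw [add_comm]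
    refine hx.add_balanced ?_
    rw [abs_e_mul, (Finset.mem_filter.1 hi).2, habs]
  rw [hE.prod_eq hP hdeg hr hmult hy0, hprod, mul_assoc, ← pow_add, h3, eval_eq_sum_range]
  refine sum_eq_of_mem (fun j _ => ?_) hE.right.mem_range rfl
  -- A term with positive exponent is balanced and absorbs everything not larger. For hi = 0 the top
  -- term P_0 is signed, but it is then the only dominant one.
  by_cases h : hi = 0
  · by_cases hj : j = hi
    · rw [hj, add_self]
    · refine add_eq_right_of_abs_lt (lt_of_le_of_ne (hE.right.abs_term_le j) fun h' => hj ?_)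
      have hjd : IsDominant P (abs (x * (1 + e))) j := by
        refine ⟨fun h0 => ?_, fun i => ?_⟩
        · rw [h0, zero_mul, map_zero] at h'
          exact abs_ne_zero (mul_ne_zero_of_ne hE.right.1 (pow_ne_zero_of_ne hy0 hi)) h'.symm
        · have := hE.right.abs_term_le i
          rw [← h'] at this
          simpa using this
      have := (hE.mem j hjd).2
      omega
  · have h1 := hE.right.abs_term_le j
    rw [mul_pow x _ hi, one_add_e_pow h, ← mul_assoc] at h1 ⊢
    refine ((hP hi).mul (hx.pow hi)).add_balanced (h1.trans ?_)
    rw [map_mul _ _ (1 + e), abs_one_add_e, mul_one]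

end Smax

theorem mainTheorem4 {Γ : Type*} [AddCommGroup Γ] [LinearOrder Γ] [IsOrderedAddMonoid Γ]
    (hΓ : ∀ k : ℕ, 0 < k → ∀ g : Γ, ∃ h : Γ, k • h = g)
    (n : ℕ) (P : Polynomial (Smax Γ)) (hP : ∀ i, (P.coeff i).IsSigned)
    (hdeg : P.degree = n)
    (r : Fin n → Smax Γ) (hr : ∀ i, (r i).IsSigned)
    (hmult : ∀ a : Smax Γ, a.IsSigned →
      Set.encard {i | r i = a} = Smax.mult a P) :
    ∀ y : Smax Γ, P.eval y = P.coeff n * ∏ i, (y + -(r i)) := by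
  classical
  have hm : ∀ a, Smax.IsSigned a → Smax.MultGE a (Smax.count r a) P := fun a ha => by
    refine Smax.multGE_of_mult_eq ?_
    rw [← hmult a ha, Smax.count, ← Set.encard_coe_eq_coe_finsetCard]
    congr 1
    ext i
    simp
  intro y
  simp only [Smax.neg_eq]
  rcases Smax.isSigned_or_balanced y with hy | ⟨x, hx, hx0, rfl⟩
  · by_cases hy0 : y = 0
    · subst hy0
      rw [← Polynomial.coeff_zero_eq_eval_zero]
      simpa only [zero_add] using Smax.coeff_zero_eq hP hdeg hr hm
    · exact Smax.eval_signed_eq hP hdeg hr hm hy hy0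
  · exact Smax.eval_balanced_eq hP hdeg hr hm hx hx0
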